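/- **Setting.** Let $f:\mathbb R^n\to\mathbb R^n$ be Lipschitz, and let $\mathcal X\subset\mathbb R^n$ be compact with differentiable boundary and outward unit normal $\nu$, such that $f(x)\cdot\nu(x)=0$ on $\partial\mathcal X$. Let $x(t;x_0)$ be the solution of $\dot x=f(x)$, $x(0)=x_0$, and $S_t(x_0)=x(t;x_0)$ its flow. Let $h:\mathcal X\to\mathbb R^m$ be continuous, $\mathcal Y=h(\mathcal X)$ and $y(t;x_0)=h(x(t;x_0))$. Fix a time step $\Delta>0$, an integer $k\ge1$ and an observation time $T=K\Delta$ with an integer $K>k$; put $\Gamma_{s}=\{\Delta l: l\in\mathbb N_0,\ \Delta l\le s\}$ and $$y_{\rm seq}(t;x_0)=\bigl(y(t-(k-1)\Delta;x_0),\dots,y(t;x_0)\bigr).$$ Assume that there is a continuous reconstruction map $G:\mathcal Y^k\to\mathcal X$ with $G(y_{\rm seq}(t;x_0))=x(t;x_0)$ for all $x_0\in\mathcal X$ and all $t\in\Gamma_T$ with $t\ge(k-1)\Delta$. Let $\mu$ be a probability measure on $\mathcal X$ with a continuous density $f_\mu$ with respect to Lebesgue measure, $f_\mu>0$ on $\mathcal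 X$. For functions $\eta_g:(\mathbb R^m)^k\to\mathbb R^m$ and $\eta_G:(\mathbb R^m)^k\to\mathbb R^n$ define the risks $$\mathcal L_{g,T}(\eta_g)=\mathbb E_{x_0\sim\mu,\ t\sim U(\Gamma_T\setminus(\Gamma_{(k-1)\Delta}\cup\{T\}))}\bigl[\|\eta_g(y_{\rm seq}(t;x_0))-y(t+\Delta;x_0)\|^2\bigr],$$ $$\mathcal L_{G,T}(\eta_G)=\mathbb E_{x_0\sim\mu,\ t\sim U(\Gamma_T\setminus\Gamma_{(k-1)\Delta})}\bigl[\|\eta_G(y_{\rm seq}(t;x_0))-x(t;x_0)\|^2\bigr],$$ where $U(A)$ is the uniform distribution on the finite set $A$, and let $\hat{\mathcal L}_{g,N,T}$, $\hat{\mathcal L}_{G,N,T}$ be the corresponding empirical risks, in which the expectation over $x_0\sim\mu$ is replaced by the average over $N$ independent draws $x_0^{(1)},\dots,x_0^{(N)}\sim\mu$. The full-state risk is $$\mathcal L_S(\eta_g,\eta_G)=\mathbb E_{x_0\sim\mu}\Bigl[\bigl\|S_\Delta(x_0)-\eta_G\bigl(y_{\rm past-}(x_0),\eta_g(y_{\rm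 past}(x_0))\bigr)\bigr\|^2\Bigr],$$ where $y_{\rm past}(x_0)=y_{\rm seq}(0;x_0)$ and $y_{\rm past-}(x_0)$ consists of its last $k-1$ entries. Let $\sigma:\mathbb R\to\mathbb R$ be a Lipschitz activation function that is not affine. A hypothesis space of neural networks is the set of all fully connected networks with activation $\sigma$, of some fixed width and depth, with all weights and biases bounded in absolute value by some fixed constant. **Theorem (autoregressive PAC-learning of $S_\Delta$).** There are hypothesis spaces of neural networks $\mathcal H_g(\varepsilon',\delta')$, $\mathcal H_G(\varepsilon',\delta')$ and sample sizes $N(\varepsilon',\delta')$, for $\varepsilon',\delta'>0$, with the following properties. For every $N\ge N(\varepsilon',\delta')$ empirical risk minimizers $$\hat\eta_{g,N,T}\in\operatorname*{argmin}_{\eta\in\mathcal H_g(\varepsilon',\delta')}\hat{\mathcal L}_{g,N,T}(\eta),\qquad \hat\eta_{G,N,T}\in\operatorname*{argmin}_{\eta\in\mathcal H_G(\varepsilon',\delta')}\hat{\mathcal L}_{G,N,T}(\eta)$$ exist, and any choice of them satisfies $$P\bigl(\mathcal L_{g,T}(\hat\eta_{g,N,T})\le\varepsilon'\bigr)\ge1-\delta'\quad\text{and}\quad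 P\bigl(\mathcal L_{G,T}(\hat\eta_{G,N,T})\le\varepsilon'\bigr)\ge1-\delta'.$$ Moreover, for all $\varepsilon,\delta>0$ there exist $\varepsilon',\delta'>0$ such that, for every $N\ge N(\varepsilon',\delta')$ (in particular for $N=N(\varepsilon',\delta')$) and for any choice of the empirical risk minimizers over $\mathcal H_g(\varepsilon',\delta')$ and $\mathcal H_G(\varepsilon',\delta')$, $$P\bigl(\mathcal L_S(\hat\eta_{g,N,T},\hat\eta_{G,N,T})\le\varepsilon\bigr)\ge1-\delta .$$ -/

import Mathlib

open MeasureTheory Set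
open scoped ENNReal NNReal

noncomputable section

/-! ### The dynamical system -/

/-- `γ` is the (global) solution of `x' = f x` with initial value `x₀`. -/
def IsTrajectory {n : ℕ} (f : EuclideanSpace ℝ (Fin n) → EuclideanSpace ℝ (Fin n))
    (x₀ : EuclideanSpace ℝ (Fin n)) (γ : ℝ → EuclideanSpace ℝ (Fin n)) : Prop :=
  γ 0 = x₀ ∧ ∀ t : ℝ, HasDerivAt γ (f (γ t)) t

open Classical in
/-- The time-`t` flow `S_t` of `x' = f x`: `flow f t x₀ = x(t)` for the solution with `x(0) = x₀`.
For globally Lipschitz `f` a unique global solution exists, and the default value is not used. -/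
def flow {n : ℕ} (f : EuclideanSpace ℝ (Fin n) → EuclideanSpace ℝ (Fin n))
    (t : ℝ) (x₀ : EuclideanSpace ℝ (Fin n)) : EuclideanSpace ℝ (Fin n) :=
  if h : ∃ γ, IsTrajectory f x₀ γ then h.choose t else x₀

/-- `ρ` is a differentiable defining function of `X` on the open neighbourhood `U` of `p`:
`X` is `{ρ ≤ 0}` in `U`, and the gradient of `ρ` has no zero in `U`. -/
def IsDefiningFunctionAt {n : ℕ} (X : Set (EuclideanSpace ℝ (Fin n)))
    (p : EuclideanSpace ℝ (Fin n)) (U : Set (EuclideanSpace ℝ (Fin n)))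
    (ρ : EuclideanSpace ℝ (Fin n) → ℝ) : Prop :=
  IsOpen U ∧ p ∈ U ∧ DifferentiableOn ℝ ρ U ∧ (∀ x ∈ U, gradient ρ x ≠ 0) ∧
    X ∩ U = {x ∈ U | ρ x ≤ 0}

/-- The boundary of `X` is differentiable. -/
def HasDifferentiableBoundary {n : ℕ} (X : Set (EuclideanSpace ℝ (Fin n))) : Prop :=
  ∀ p ∈ frontier X, ∃ U ρ, IsDefiningFunctionAt X p U ρ

/-- `ν` is the outward unit normal of `X` at the boundary point `p`. -/
def IsOutwardUnitNormal {n : ℕ} (X : Set (EuclideanSpace ℝ (Fin n)))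
    (p ν : EuclideanSpace ℝ (Fin n)) : Prop :=
  ∃ U ρ, IsDefiningFunctionAt X p U ρ ∧ ν = ‖gradient ρ p‖⁻¹ • gradient ρ p

/-- `f` is tangential to the boundary of `X`: `f(p) · ν(p) = 0` for all `p ∈ ∂X`. -/
def IsTangentialTo {n : ℕ} (f : EuclideanSpace ℝ (Fin n) → EuclideanSpace ℝ (Fin n))
    (X : Set (EuclideanSpace ℝ (Fin n))) : Prop :=
  ∀ p ∈ frontier X, ∀ ν, IsOutwardUnitNormal X p ν → inner ℝ (f p) ν = 0

/-! ### Tokens -/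

/-- The token `y(t; x₀) = h(x(t; x₀))`. -/
def token {n m : ℕ} (f : EuclideanSpace ℝ (Fin n) → EuclideanSpace ℝ (Fin n))
    (h : EuclideanSpace ℝ (Fin n) → EuclideanSpace ℝ (Fin m))
    (t : ℝ) (x₀ : EuclideanSpace ℝ (Fin n)) : EuclideanSpace ℝ (Fin m) :=
  h (flow f t x₀)

/-- The measurement sequence `y_seq(t; x₀) = (y(t - (k-1)Δ), y(t - (k-2)Δ), …, y(t))`. -/
def ySeq {n m : ℕ} (f : EuclideanSpace ℝ (Fin n) → EuclideanSpace ℝ (Fin n))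
    (h : EuclideanSpace ℝ (Fin n) → EuclideanSpace ℝ (Fin m)) (Δ : ℝ) (k : ℕ)
    (t : ℝ) (x₀ : EuclideanSpace ℝ (Fin n)) : Fin k → EuclideanSpace ℝ (Fin m) :=
  fun i => token f h (t - ((k : ℝ) - 1 - (i : ℕ)) * Δ) x₀

/-- Drop the oldest entry of a window of length `k` and append the new entry `a`. -/
def shiftAppend {α : Type*} {k : ℕ} (y : Fin k → α) (a : α) : Fin k → α :=
  fun i => if hi : (i : ℕ) + 1 < k then y ⟨(i : ℕ) + 1, hi⟩ else a

/-! ### Fully connected neural networks -/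

/-- An affine layer: a weight matrix and a bias vector. -/
abbrev AffineLayer (ι κ : Type) : Type := Matrix κ ι ℝ × (κ → ℝ)

/-- The affine map `x ↦ A x + b` of a layer. -/
def AffineLayer.apply {ι κ : Type} [Fintype ι] (a : AffineLayer ι κ) (x : ι → ℝ) : κ → ℝ :=
  fun i => (∑ j, a.1 i j * x j) + a.2 i

/-- All weights and biases of the layer are bounded by `M` in absolute value. -/
def AffineLayer.BoundedBy {ι κ : Type} (a : AffineLayer ι κ) (M : ℝ) : Prop :=
  (∀ i j, |a.1 i j| ≤ M) ∧ ∀ i, |a.2 i| ≤ M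

/-- The weights of a fully connected network with `D + 1` hidden layers, each of width `W`:
the input layer, `D` layers between hidden layers, and the output layer. -/
abbrev NetWeights (ι κ : Type) (W D : ℕ) : Type :=
  AffineLayer ι (Fin W) × (Fin D → AffineLayer (Fin W) (Fin W)) × AffineLayer (Fin W) κ

/-- All weights and biases of the network are bounded by `M` in absolute value. -/
def NetWeights.BoundedBy {ι κ : Type} {W D : ℕ} (θ : NetWeights ι κ W D) (M : ℝ) : Prop :=
  AffineLayer.BoundedBy θ.1 M ∧ (∀ l, AffineLayer.BoundedBy (θ.2.1 l) M) ∧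
    AffineLayer.BoundedBy θ.2.2 M

/-- Pass the hidden state `z` through `D` successive layers `x ↦ σ(A x + b)`. -/
def hiddenLayers (σ : ℝ → ℝ) {W : ℕ} :
    (D : ℕ) → (Fin D → AffineLayer (Fin W) (Fin W)) → (Fin W → ℝ) → (Fin W → ℝ)
  | 0, _, z => z
  | D + 1, θ, z => hiddenLayers σ D (fun l => θ l.succ) (fun i => σ ((θ 0).apply z i))

/-- The function computed by the network with activation `σ` and weights `θ`. -/
def NetWeights.eval (σ : ℝ → ℝ) {ι κ : Type} [Fintype ι] {W D : ℕ} (θ : NetWeights ι κ W D)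
    (x : ι → ℝ) : κ → ℝ :=
  AffineLayer.apply θ.2.2
    (hiddenLayers σ D θ.2.1 (fun i => σ (AffineLayer.apply θ.1 x i)))

/-- The network as a function of `k` tokens in `ℝ^m` (read as one vector of length `k m`) with
values in `ℝ^q`. -/
def NetWeights.toFun (σ : ℝ → ℝ) {k m q W D : ℕ}
    (θ : NetWeights (Fin k × Fin m) (Fin q) W D)
    (y : Fin k → EuclideanSpace ℝ (Fin m)) : EuclideanSpace ℝ (Fin q) :=
  WithLp.toLp 2 (θ.eval σ (fun p => y p.1 p.2))

/-- The set of all functions computed by fully connected networks with activation `σ`, with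
`D + 1` hidden layers of width `W` and with all weights and biases in `[-M, M]`. -/
def networkClass (σ : ℝ → ℝ) (k m q W D : ℕ) (M : ℝ) :
    Set ((Fin k → EuclideanSpace ℝ (Fin m)) → EuclideanSpace ℝ (Fin q)) :=
  {η | ∃ θ : NetWeights (Fin k × Fin m) (Fin q) W D, θ.BoundedBy M ∧ η = θ.toFun σ}

/-- `H` is the hypothesis space of all fully connected networks of some fixed width and depth,
with weights and biases bounded by some fixed constant. -/
def IsNetworkHypothesisSpace (σ : ℝ → ℝ) {k m q : ℕ}
    (H : Set ((Fin k → EuclideanSpace ℝ (Fin m)) → EuclideanSpace ℝ (Fin q))) : Prop :=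
  ∃ (W D : ℕ) (M : ℝ), 0 < M ∧ H = networkClass σ k m q W D M

/-! ### Risks

Times in `Γ_T`, `T = K Δ`, are written `l Δ` with `l ∈ {0, …, K}`. -/

/-- Indices of `Γ_T \ (Γ_{(k-1)Δ} ∪ {T})`. -/
def timesLatent (k K : ℕ) : Finset ℕ := Finset.range (K + 1) \ (Finset.range k ∪ {K})

/-- Indices of `Γ_T \ Γ_{(k-1)Δ}`. -/
def timesDecoder (k K : ℕ) : Finset ℕ := Finset.range (K + 1) \ Finset.range k

/-- The squared one-step latent prediction error of `η` on the trajectory of `x`, at time `l Δ`. -/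
def latentLoss {n m : ℕ} (f : EuclideanSpace ℝ (Fin n) → EuclideanSpace ℝ (Fin n))
    (h : EuclideanSpace ℝ (Fin n) → EuclideanSpace ℝ (Fin m)) (Δ : ℝ) (k : ℕ)
    (η : (Fin k → EuclideanSpace ℝ (Fin m)) → EuclideanSpace ℝ (Fin m))
    (l : ℕ) (x : EuclideanSpace ℝ (Fin n)) : ℝ :=
  ‖η (ySeq f h Δ k (l * Δ) x) - token f h (l * Δ + Δ) x‖ ^ 2

/-- The squared reconstruction error of `η` on the trajectory of `x`, at time `l Δ`. -/
def decoderLoss {n m : ℕ} (f : EuclideanSpace ℝ (Fin n) → EuclideanSpace ℝ (Fin n))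
    (h : EuclideanSpace ℝ (Fin n) → EuclideanSpace ℝ (Fin m)) (Δ : ℝ) (k : ℕ)
    (η : (Fin k → EuclideanSpace ℝ (Fin m)) → EuclideanSpace ℝ (Fin n))
    (l : ℕ) (x : EuclideanSpace ℝ (Fin n)) : ℝ :=
  ‖η (ySeq f h Δ k (l * Δ) x) - flow f (l * Δ) x‖ ^ 2

/-- The expectation of `loss t x₀` over `x₀ ∼ μ` and `t` uniformly distributed on `times`. -/
def populationRisk {E : Type} [MeasurableSpace E] (μ : Measure E) (times : Finset ℕ)
    (loss : ℕ → E → ℝ) : ℝ≥0∞ :=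
  (times.card : ℝ≥0∞)⁻¹ * ∑ l ∈ times, ∫⁻ x, ENNReal.ofReal (loss l x) ∂μ

/-- The average of `loss t x₀` over the sample `s` of initial conditions and over `times`. -/
def empiricalRisk {E : Type} {N : ℕ} (s : Fin N → E) (times : Finset ℕ)
    (loss : ℕ → E → ℝ) : ℝ :=
  ((N : ℝ) * (times.card : ℝ))⁻¹ * ∑ j, ∑ l ∈ times, loss l (s j)

/-- `𝓛_{g,T}(η)` for `T = K Δ`. -/
def riskLatent {n m : ℕ} (f : EuclideanSpace ℝ (Fin n) → EuclideanSpace ℝ (Fin n))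
    (h : EuclideanSpace ℝ (Fin n) → EuclideanSpace ℝ (Fin m))
    (μ : Measure (EuclideanSpace ℝ (Fin n))) (Δ : ℝ) (k K : ℕ)
    (η : (Fin k → EuclideanSpace ℝ (Fin m)) → EuclideanSpace ℝ (Fin m)) : ℝ≥0∞ :=
  populationRisk μ (timesLatent k K) (latentLoss f h Δ k η)

/-- `𝓛_{G,T}(η)` for `T = K Δ`. -/
def riskDecoder {n m : ℕ} (f : EuclideanSpace ℝ (Fin n) → EuclideanSpace ℝ (Fin n))
    (h : EuclideanSpace ℝ (Fin n) → EuclideanSpace ℝ (Fin m))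
    (μ : Measure (EuclideanSpace ℝ (Fin n))) (Δ : ℝ) (k K : ℕ)
    (η : (Fin k → EuclideanSpace ℝ (Fin m)) → EuclideanSpace ℝ (Fin n)) : ℝ≥0∞ :=
  populationRisk μ (timesDecoder k K) (decoderLoss f h Δ k η)

/-- The full-state risk
`𝓛_S(η_g, η_G) = 𝔼_{x₀ ∼ μ} ‖S_Δ(x₀) - η_G(y_{past-}(x₀), η_g(y_past(x₀)))‖²`, where
`y_past(x₀) = y_seq(0; x₀)` and `y_{past-}(x₀)` is `y_past(x₀)` without its oldest entry. -/
def riskFullState {n m : ℕ} (f : EuclideanSpace ℝ (Fin n) → EuclideanSpace ℝ (Fin n))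
    (h : EuclideanSpace ℝ (Fin n) → EuclideanSpace ℝ (Fin m))
    (μ : Measure (EuclideanSpace ℝ (Fin n))) (Δ : ℝ) (k : ℕ)
    (ηg : (Fin k → EuclideanSpace ℝ (Fin m)) → EuclideanSpace ℝ (Fin m))
    (ηG : (Fin k → EuclideanSpace ℝ (Fin m)) → EuclideanSpace ℝ (Fin n)) : ℝ≥0∞ :=
  ∫⁻ x, ENNReal.ofReal
    (‖flow f Δ x - ηG (shiftAppend (ySeq f h Δ k 0 x) (ηg (ySeq f h Δ k 0 x)))‖ ^ 2) ∂μ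

/-! ### Empirical risk minimization -/

/-- `est` maps every sample from `X` to a minimizer over `H` of the empirical risk of that
sample. -/
def IsERM {E F : Type} {N : ℕ} (X : Set E) (times : Finset ℕ) (loss : F → ℕ → E → ℝ)
    (H : Set F) (est : (Fin N → E) → F) : Prop :=
  ∀ s : Fin N → E, (∀ j, s j ∈ X) →
    est s ∈ H ∧ IsMinOn (fun η => empiricalRisk s times (loss η)) H (est s)

/-- The event `A` has probability at least `p`. No measurability of `A` is needed: `A` has to
contain a measurable event of probability at least `p`. -/
def ProbAtLeast {Ω : Type} [MeasurableSpace Ω] (P : Measure Ω) (p : ℝ) (A : Set Ω) : Prop :=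
  ∃ B ⊆ A, MeasurableSet B ∧ ENNReal.ofReal p ≤ P B

end

/-! Put g = h ∘ S_Δ ∘ G. Since G recovers the state from a window, g is the exact one-step map of
the tokens on observed windows, and g and G are continuous on the compact set Y^k. Learning them is
approximation followed by uniform convergence. The harder step is to pass from these two risks to
the full-state risk, where two obstacles appear.

The first is a mismatch of times: the full-state risk uses the window ending at time 0, which may
reach into negative times, whereas the training windows end at kΔ or later. The flow preserves X
(`flow_mem`) and is bi-Lipschitz, and μ is comparable to Lebesgue measure on X. So μ is dominated by
a multiple of its image under S_{kΔ} (`exists_lintegral_le_lintegral_flow`), and replacing x by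
S_{kΔ}(x) moves the window to time kΔ.

The second is that the learned decoder magnifies latent errors by its Lipschitz constant Λ, which
may grow with the accuracy demanded of the decoder. The order of choice resolves this: the decoder
class for ε' comes first, its members share one Λ (`exists_lipschitz_toFun`), and then the latent
class is chosen for the accuracy ε' / (1 + Λ²). `exists_riskFullState_le` bounds the full-state risk
by C ε' with C independent of Λ.

For the learning itself (`exists_networkClass_learns`), one hidden layer is enough. Neurons span a
dense subspace (`span_ridge_dense`): a mollified σ is not a polynomial, derivatives in the scale of
its argument produce powers, hence exponentials, and Stone–Weierstrass applies. Bounded weights form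
a compact set, so a finite net with Chebyshev's inequality controls all networks at once
(`exists_uniform_deviation`). The good event does not depend on the choice of minimizer, so
estimators need not be measurable. -/

/-! ### The flow of a globally Lipschitz vector field -/

section Flow

open Filter Topology

/-- Solutions with the same initial value agree on open intervals. -/
theorem eqOn_Ioo_of_hasDerivAt {E : Type*} [NormedAddCommGroup E] [NormedSpace ℝ E]
    {f : E → E} {L : ℝ≥0} (hf : LipschitzWith L f) {a b t₀ : ℝ} {γ₁ γ₂ : ℝ → E}
    (ht : t₀ ∈ Ioo a b)
    (h₁ : ∀ t ∈ Ioo a b, HasDerivAt γ₁ (f (γ₁ t)) t)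
    (h₂ : ∀ t ∈ Ioo a b, HasDerivAt γ₂ (f (γ₂ t)) t) (h₀ : γ₁ t₀ = γ₂ t₀) :
    EqOn γ₁ γ₂ (Ioo a b) :=
  ODE_solution_unique_of_mem_Ioo (v := fun _ => f) (s := fun _ => univ) (K := L)
    (fun _ _ => hf.lipschitzOnWith) ht (fun t h => ⟨h₁ t h, trivial⟩)
    (fun t h => ⟨h₂ t h, trivial⟩) h₀

/-- A Lipschitz vector field has solutions on an interval whose length does not depend on the
initial value. -/
theorem exists_uniform_time_solution {E : Type*} [NormedAddCommGroup E] [NormedSpace ℝ E]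
    [CompleteSpace E] {f : E → E} {L : ℝ≥0} (hf : LipschitzWith L f) (x₀ : E) :
    ∃ γ : ℝ → E, γ 0 = x₀ ∧
      ∀ t ∈ Ioo (-(1 / (2 * ((L : ℝ) + 1)))) (1 / (2 * ((L : ℝ) + 1))),
        HasDerivAt γ (f (γ t)) t := by
  -- On the ball of radius ‖f x₀‖ about x₀ the speed is at most (1 + L)‖f x₀‖, so within this time a
  -- solution travels at most half the radius. The factor ‖f x₀‖ cancels, which makes the time
  -- uniform.
  set ε : ℝ := 1 / (2 * ((L : ℝ) + 1)) with hε
  have hεpos : 0 < ε := by positivity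
  set a : ℝ≥0 := ‖f x₀‖₊ with ha
  have hpl : IsPicardLindelof (fun _ => f) (tmin := -ε) (tmax := ε)
      ⟨0, by constructor <;> linarith⟩ x₀ a 0 (‖f x₀‖₊ + L * a) L := by
    refine IsPicardLindelof.of_time_independent ?_ hf.lipschitzOnWith ?_
    · intro x hx
      have h1 : ‖f x - f x₀‖ ≤ L * ‖x - x₀‖ := by
        simpa [dist_eq_norm] using hf.dist_le_mul x x₀
      have h2 : ‖x - x₀‖ ≤ a := by simpa [dist_eq_norm] using hx
      have h3 : ‖f x‖ ≤ ‖f x₀‖ + ‖f x - f x₀‖ := norm_le_norm_add_norm_sub' _ _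
      have h4 : (L : ℝ) * ‖x - x₀‖ ≤ L * a := by gcongr
      simp only [NNReal.coe_add, NNReal.coe_mul, coe_nnnorm]
      linarith
    · simp only [NNReal.coe_add, NNReal.coe_mul, coe_nnnorm, ha, sub_zero, zero_sub, neg_neg,
        max_self, NNReal.coe_zero]
      have h1 : ((L : ℝ) + 1) * ε = 1 / 2 := by rw [hε]; field_simp
      have : (‖f x₀‖ + L * ‖f x₀‖) * ε = ‖f x₀‖ * (((L : ℝ) + 1) * ε) := by ring
      rw [this, h1]
      linarith [norm_nonneg (f x₀)]
  obtain ⟨γ, h0, hγ⟩ := hpl.exists_eq_forall_mem_Icc_hasDerivWithinAt₀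
  exact ⟨γ, h0, fun t ht => (hγ t (Ioo_subset_Icc_self ht)).hasDerivAt (Icc_mem_nhds ht.1 ht.2)⟩

/-- Two solutions on shifted copies of `(-T, T)` are glued to a solution on `(-3T/2, 3T/2)`. -/
theorem exists_solution_extend {E : Type*} [NormedAddCommGroup E] [NormedSpace ℝ E]
    {f : E → E} {L : ℝ≥0} (hf : LipschitzWith L f) {T : ℝ} (hT : 0 < T)
    (H : ∀ x₀ : E, ∃ γ : ℝ → E, γ 0 = x₀ ∧ ∀ t ∈ Ioo (-T) T, HasDerivAt γ (f (γ t)) t) (x₀ : E) :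
    ∃ γ : ℝ → E, γ 0 = x₀ ∧
      ∀ t ∈ Ioo (-(3 / 2 * T)) (3 / 2 * T), HasDerivAt γ (f (γ t)) t := by
  -- The solutions restarted at ±T/2 overlap the given one, and uniqueness makes them agree with it
  -- on the overlaps.
  obtain ⟨γ, h0, hγ⟩ := H x₀
  obtain ⟨γp, hp0, hγp⟩ := H (γ (T / 2))
  obtain ⟨γm, hm0, hγm⟩ := H (γ (-(T / 2)))
  have hP : ∀ t ∈ Ioo (-(T / 2)) (3 / 2 * T),
      HasDerivAt (fun t => γp (t - T / 2)) (f (γp (t - T / 2))) t := fun t ht =>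
    (hγp (t - T / 2) ⟨by linarith [ht.1], by linarith [ht.2]⟩).comp_sub_const t (T / 2)
  have hM : ∀ t ∈ Ioo (-(3 / 2 * T)) (T / 2),
      HasDerivAt (fun t => γm (t + T / 2)) (f (γm (t + T / 2))) t := fun t ht =>
    (hγm (t + T / 2) ⟨by linarith [ht.1], by linarith [ht.2]⟩).comp_add_const t (T / 2)
  have eP : EqOn (fun t => γp (t - T / 2)) γ (Ioo (-(T / 2)) T) :=
    eqOn_Ioo_of_hasDerivAt (t₀ := T / 2) hf ⟨by linarith, by linarith⟩
      (fun t ht => hP t ⟨ht.1, by linarith [ht.2]⟩)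
      (fun t ht => hγ t ⟨by linarith [ht.1], ht.2⟩) (by simp [hp0])
  have eM : EqOn (fun t => γm (t + T / 2)) γ (Ioo (-T) (T / 2)) :=
    eqOn_Ioo_of_hasDerivAt (t₀ := -(T / 2)) hf ⟨by linarith, by linarith⟩
      (fun t ht => hM t ⟨by linarith [ht.1], ht.2⟩)
      (fun t ht => hγ t ⟨ht.1, by linarith [ht.2]⟩) (by simp [hm0])
  set Γ : ℝ → E := fun t => if 0 ≤ t then γp (t - T / 2) else γm (t + T / 2) with hΓ
  have eΓ : EqOn Γ γ (Ioo (-(T / 2)) (T / 2)) := by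
    intro t ht
    by_cases h : 0 ≤ t
    · simp only [hΓ, h, if_true]
      exact eP ⟨ht.1, by linarith [ht.2]⟩
    · simp only [hΓ, h, if_false]
      exact eM ⟨by linarith [ht.1], ht.2⟩
  refine ⟨Γ, (eΓ ⟨by linarith, by linarith⟩).trans h0, fun t ht => ?_⟩
  have key : ∀ (β : ℝ → E) (s : Set ℝ), s ∈ 𝓝 t → EqOn Γ β s → HasDerivAt β (f (β t)) t →
      HasDerivAt Γ (f (Γ t)) t := fun β s hs he hd => by
    rw [he (mem_of_mem_nhds hs)]
    exact hd.congr_of_eventuallyEq (he.eventuallyEq_of_mem hs)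
  rcases lt_trichotomy t 0 with h | h | h
  · refine key _ (Iio 0) (Iio_mem_nhds h) (fun s hs => ?_) (hM t ⟨ht.1, by linarith⟩)
    simp [hΓ, not_le.2 (mem_Iio.1 hs)]
  · subst h
    exact key γ _ (Ioo_mem_nhds (by linarith) (by linarith)) eΓ (hγ 0 ⟨by linarith, hT⟩)
  · refine key _ (Ioi 0) (Ioi_mem_nhds h) (fun s hs => ?_) (hP t ⟨by linarith, ht.2⟩)
    simp [hΓ, (mem_Ioi.1 hs).le]

/-- The local existence time is independent of the initial value, so the extension by the factor 3/2
can be iterated. By uniqueness the solutions on the growing intervals are compatible. -/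
theorem exists_global_solution {E : Type*} [NormedAddCommGroup E] [NormedSpace ℝ E]
    [CompleteSpace E] {f : E → E} {L : ℝ≥0} (hf : LipschitzWith L f) (x₀ : E) :
    ∃ γ : ℝ → E, γ 0 = x₀ ∧ ∀ t, HasDerivAt γ (f (γ t)) t := by
  set ε : ℝ := 1 / (2 * ((L : ℝ) + 1)) with hε
  have hεpos : 0 < ε := by positivity
  have hn : ∀ n : ℕ, ∀ x₀ : E, ∃ γ : ℝ → E, γ 0 = x₀ ∧
      ∀ t ∈ Ioo (-((3 / 2) ^ n * ε)) ((3 / 2) ^ n * ε), HasDerivAt γ (f (γ t)) t := by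
    intro n
    induction n with
    | zero =>
      simp only [pow_zero, one_mul]
      exact fun x₀ => exists_uniform_time_solution hf x₀
    | succ n ih =>
      intro x₀
      have := exists_solution_extend hf (by positivity) ih x₀
      simpa only [pow_succ', mul_assoc] using this
  choose γ h0 hγ using fun n => hn n x₀
  have hcover : ∀ t : ℝ, ∃ n : ℕ, |t| < (3 / 2) ^ n * ε := fun t => by
    obtain ⟨n, hn⟩ := pow_unbounded_of_one_lt (|t| / ε) (by norm_num : (1 : ℝ) < 3 / 2)
    exact ⟨n, (div_lt_iff₀ hεpos).1 hn⟩
  have hagree : ∀ i j t, |t| < (3 / 2) ^ i * ε → |t| < (3 / 2) ^ j * ε → γ i t = γ j t := by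
    intro i j t hi hj
    have hpos : 0 < min ((3 / 2 : ℝ) ^ i * ε) ((3 / 2) ^ j * ε) := by positivity
    refine eqOn_Ioo_of_hasDerivAt (t₀ := 0)
      (a := -min ((3 / 2) ^ i * ε) ((3 / 2) ^ j * ε)) (b := min ((3 / 2) ^ i * ε) ((3 / 2) ^ j * ε))
      hf ⟨by linarith, hpos⟩ (fun s hs => hγ i s ?_) (fun s hs => hγ j s ?_) ?_ ?_
    · exact abs_lt.1 ((abs_lt.2 hs).trans_le (min_le_left _ _))
    · exact abs_lt.1 ((abs_lt.2 hs).trans_le (min_le_right _ _))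
    · rw [h0, h0]
    · exact abs_lt.1 (lt_min hi hj)
  choose N hN using hcover
  refine ⟨fun t => γ (N t) t, h0 _, fun t => ?_⟩
  have h1 := hγ (N t) t (abs_lt.1 (hN t))
  refine h1.congr_of_eventuallyEq ?_
  filter_upwards [continuous_abs.continuousAt.eventually_lt continuousAt_const (hN t)] with s hs
  exact hagree _ _ _ (hN s) hs

variable {n : ℕ} {f : EuclideanSpace ℝ (Fin n) → EuclideanSpace ℝ (Fin n)} {L : ℝ≥0}

theorem isTrajectory_flow (hf : LipschitzWith L f) (x₀ : EuclideanSpace ℝ (Fin n)) :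
    IsTrajectory f x₀ (fun t => flow f t x₀) := by
  have h : ∃ γ, IsTrajectory f x₀ γ := exists_global_solution hf x₀
  have : (fun t => flow f t x₀) = h.choose := by
    funext t
    simp [flow, h]
  rw [this]
  exact h.choose_spec

theorem flow_zero (hf : LipschitzWith L f) (x : EuclideanSpace ℝ (Fin n)) : flow f 0 x = x :=
  (isTrajectory_flow hf x).1

theorem hasDerivAt_flow (hf : LipschitzWith L f) (x : EuclideanSpace ℝ (Fin n)) (t : ℝ) :
    HasDerivAt (fun t => flow f t x) (f (flow f t x)) t :=
  (isTrajectory_flow hf x).2 t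

theorem continuous_flow_time (hf : LipschitzWith L f) (x : EuclideanSpace ℝ (Fin n)) :
    Continuous fun t => flow f t x :=
  continuous_iff_continuousAt.2 fun t => (hasDerivAt_flow hf x t).continuousAt

/-- Global trajectories are determined by their initial value. -/
theorem IsTrajectory.eq_flow (hf : LipschitzWith L f) {x : EuclideanSpace ℝ (Fin n)}
    {γ : ℝ → EuclideanSpace ℝ (Fin n)} (hγ : IsTrajectory f x γ) (t : ℝ) : γ t = flow f t x :=
  congrFun (ODE_solution_unique_univ (t₀ := 0) (v := fun _ => f) (s := fun _ => univ) (K := L)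
    (fun _ => hf.lipschitzOnWith) (fun t => ⟨hγ.2 t, trivial⟩)
    (fun t => ⟨hasDerivAt_flow hf x t, trivial⟩) (by rw [hγ.1, flow_zero hf])) t

theorem flow_add (hf : LipschitzWith L f) (s t : ℝ) (x : EuclideanSpace ℝ (Fin n)) :
    flow f (s + t) x = flow f s (flow f t x) :=
  IsTrajectory.eq_flow (γ := fun s => flow f (s + t) x) hf
    ⟨by simp, fun s => (hasDerivAt_flow hf x (s + t)).comp_add_const s t⟩ s

theorem flow_neg (hf : LipschitzWith L f) (t : ℝ) (x : EuclideanSpace ℝ (Fin n)) :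
    flow (fun y => -f y) t x = flow f (-t) x := by
  have hf' : LipschitzWith L (fun y => -f y) := hf.neg
  refine (IsTrajectory.eq_flow (γ := fun s => flow f (-s) x) hf' ⟨by simp [flow_zero hf], ?_⟩ t).symm
  intro s
  have := (hasDerivAt_flow hf x (-s)).scomp s (hasDerivAt_neg s)
  simpa [Function.comp_def] using this

theorem dist_flow_le (hf : LipschitzWith L f) {t : ℝ} (ht : 0 ≤ t)
    (x y : EuclideanSpace ℝ (Fin n)) :
    dist (flow f t x) (flow f t y) ≤ dist x y * Real.exp (L * t) := by
  have := dist_le_of_trajectories_ODE (v := fun _ => f) (K := L) (a := 0) (b := t)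
    (f := fun t => flow f t x) (g := fun t => flow f t y) (δ := dist x y) (fun _ => hf)
    (continuous_flow_time hf x).continuousOn
    (fun s _ => (hasDerivAt_flow hf x s).hasDerivWithinAt)
    (continuous_flow_time hf y).continuousOn
    (fun s _ => (hasDerivAt_flow hf y s).hasDerivWithinAt)
    (by simp [flow_zero hf]) t ⟨ht, le_rfl⟩
  simpa using this

theorem lipschitzWith_flow (hf : LipschitzWith L f) (t : ℝ) :
    LipschitzWith (Real.exp (L * |t|)).toNNReal (flow f t) := by
  refine LipschitzWith.of_dist_le_mul fun x y => ?_
  rw [Real.coe_toNNReal _ (Real.exp_pos _).le, mul_comm]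
  rcases le_total 0 t with h | h
  · simpa [abs_of_nonneg h] using dist_flow_le hf h x y
  · have hf' : LipschitzWith L (fun y => -f y) := hf.neg
    have := dist_flow_le hf' (neg_nonneg.2 h) x y
    simpa [flow_neg hf, abs_of_nonpos h] using this

theorem continuous_flow (hf : LipschitzWith L f) (t : ℝ) : Continuous (flow f t) :=
  (lipschitzWith_flow hf t).continuous

/-- The time-`t` flow as a homeomorphism. -/
noncomputable def flowHomeomorph (hf : LipschitzWith L f) (t : ℝ) :
    EuclideanSpace ℝ (Fin n) ≃ₜ EuclideanSpace ℝ (Fin n) where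
  toFun := flow f t
  invFun := flow f (-t)
  left_inv x := by rw [← flow_add hf, neg_add_cancel, flow_zero hf]
  right_inv x := by rw [← flow_add hf, add_neg_cancel, flow_zero hf]
  continuous_toFun := continuous_flow hf t
  continuous_invFun := continuous_flow hf (-t)

end Flow

/-! ### Invariance of the state space -/

section Invariance

open Filter Topology

variable {n : ℕ} {f : EuclideanSpace ℝ (Fin n) → EuclideanSpace ℝ (Fin n)} {L : ℝ≥0}
  {X : Set (EuclideanSpace ℝ (Fin n))}

/-- The Bouligand tangency condition along trajectories that start in `X`. -/
theorem eventually_infDist_flow_le (hf : LipschitzWith L f)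
    (hXb : HasDifferentiableBoundary X) (hfX : IsTangentialTo f X)
    {p : EuclideanSpace ℝ (Fin n)} (hp : p ∈ X) {η : ℝ} (hη : 0 < η) :
    ∀ᶠ s in 𝓝[>] (0 : ℝ), Metric.infDist (flow f s p) X ≤ η * s := by
  by_cases hint : p ∈ interior X
  · have hc : Tendsto (fun s => flow f s p) (𝓝 0) (𝓝 p) := by
      simpa [flow_zero hf] using (continuous_flow_time hf p).tendsto 0
    filter_upwards [(hc.eventually (mem_interior_iff_mem_nhds.1 hint)).filter_mono
      nhdsWithin_le_nhds, self_mem_nhdsWithin] with s hs hs0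
    rw [Metric.infDist_zero_of_mem hs]
    exact mul_nonneg hη.le (le_of_lt hs0)
  have hfr : p ∈ frontier X := ⟨subset_closure hp, hint⟩
  obtain ⟨U, ρ, hU⟩ := hXb p hfr
  have htan := hfX p hfr _ ⟨U, ρ, hU, rfl⟩
  obtain ⟨hUo, hpU, hdiff, hgrad, hXU⟩ := hU
  set g := gradient ρ p with hg
  have hg0 : 0 < ‖g‖ := norm_pos_iff.2 (hgrad p hpU)
  have hfg : inner ℝ (f p) g = 0 := by
    rw [inner_smul_right] at htan
    exact (mul_eq_zero.1 htan).resolve_left (inv_ne_zero hg0.ne')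
  have hρ : HasGradientAt ρ g p :=
    ((hdiff p hpU).differentiableAt (hUo.mem_nhds hpU)).hasGradientAt
  -- The tangent line at p may leave X, because ρ vanishes on it only to first order. Tilting it
  -- inwards by `a • g` makes ρ strictly decrease at first order, and the tilt has speed ‖a • g‖ = η
  -- / 2 < η.
  set a : ℝ := η / (2 * ‖g‖) with ha
  have hapos : 0 < a := by positivity
  set c : ℝ → EuclideanSpace ℝ (Fin n) := fun s => p + s • (f p - a • g) with hc
  have hc0 : c 0 = p := by simp [hc]
  have hcd : HasDerivAt c (f p - a • g) 0 := by
    have := ((hasDerivAt_id (0 : ℝ)).smul_const (f p - a • g)).const_add p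
    rwa [one_smul] at this
  have hρc : HasDerivAt (fun s => ρ (c s)) (-(a * ‖g‖ ^ 2)) 0 := by
    have h1 : HasFDerivAt ρ (InnerProductSpace.toDual ℝ _ g) (c 0) := by
      rw [hc0]; exact hρ.hasFDerivAt
    have := h1.comp_hasDerivAt 0 hcd
    refine this.congr_deriv ?_
    rw [InnerProductSpace.toDual_apply_apply, inner_sub_right, inner_smul_right,
      real_inner_self_eq_norm_sq, real_inner_comm, hfg]
    ring
  have hneg : -(a * ‖g‖ ^ 2) < 0 := by
    have : 0 < a * ‖g‖ ^ 2 := by positivity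
    linarith
  have e1 : ∀ᶠ s in 𝓝[>] (0 : ℝ), slope (fun s => ρ (c s)) 0 s < 0 :=
    (hρc.hasDerivWithinAt (s := Ioi 0)).limsup_slope_le' (by simp) hneg
  have e2 : ∀ᶠ s in 𝓝[>] (0 : ℝ), c s ∈ U :=
    (hcd.continuousAt.eventually (hUo.mem_nhds (by rw [hc0]; exact hpU))).filter_mono
      nhdsWithin_le_nhds
  have hdd : HasDerivAt (fun s => flow f s p - c s) (a • g) 0 := by
    have h1 := hasDerivAt_flow hf p 0
    rw [flow_zero hf] at h1
    simpa using h1.fun_sub hcd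
  have hnorm : ‖a • g‖ < η := by
    rw [norm_smul, Real.norm_of_nonneg hapos.le, ha]
    have : η / (2 * ‖g‖) * ‖g‖ = η / 2 := by field_simp
    rw [this]; linarith
  have e3 := (hdd.hasDerivWithinAt (s := Ioi 0)).limsup_norm_slope_le hnorm
  filter_upwards [e1, e2, e3, self_mem_nhdsWithin] with s h1 h2 h3 hs
  have hs0 : (0 : ℝ) < s := hs
  have hcX : c s ∈ X := by
    have hle : ρ p ≤ 0 := by
      have : p ∈ X ∩ U := ⟨hp, hpU⟩
      rw [hXU] at this
      exact this.2
    have hlt : ρ (c s) - ρ (c 0) < 0 := by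
      rw [slope_def_field, sub_zero] at h1
      rcases div_neg_iff.1 h1 with h | h
      · linarith [h.2]
      · exact h.1
    have : c s ∈ X ∩ U := by
      rw [hXU]
      refine ⟨h2, ?_⟩
      rw [hc0] at hlt
      linarith
    exact this.1
  refine (Metric.infDist_le_dist_of_mem hcX).trans ?_
  rw [dist_eq_norm]
  simp only [flow_zero hf, hc0, sub_self, sub_zero, Real.norm_of_nonneg hs0.le] at h3
  rw [inv_mul_lt_iff₀ hs0] at h3
  linarith

/-- A compact set with differentiable boundary is forward invariant under the flow of a tangential
Lipschitz vector field. -/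
theorem flow_mem_of_nonneg (hf : LipschitzWith L f) (hX : IsCompact X)
    (hXb : HasDifferentiableBoundary X) (hfX : IsTangentialTo f X)
    {x : EuclideanSpace ℝ (Fin n)} (hx : x ∈ X) {t : ℝ} (ht : 0 ≤ t) : flow f t x ∈ X := by
  have hne : X.Nonempty := ⟨x, hx⟩
  set d : ℝ → ℝ := fun t => Metric.infDist (flow f t x) X with hd
  have hdc : Continuous d :=
    (Metric.continuous_infDist_pt X).comp (continuous_flow_time hf x)
  have key := le_gronwallBound_of_liminf_deriv_right_le (f := d) (f' := fun t => L * d t)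
    (δ := 0) (K := L) (ε := 0) (a := 0) (b := t) hdc.continuousOn ?_ ?_ (fun s _ => by simp)
    t ⟨ht, le_rfl⟩
  · rw [sub_zero, gronwallBound_ε0_δ0] at key
    exact (hX.isClosed.mem_iff_infDist_zero hne).2 (le_antisymm key Metric.infDist_nonneg)
  · intro u _ r hr
    -- Compare with the trajectory of a nearest point p: it leaves X at rate at most η, and the two
    -- trajectories separate at most like exp(L s). With η half of the slack in r, both
    -- contributions fit below r. So d grows at rate at most L d from d(0) = 0, and Grönwall gives d
    -- = 0.
    obtain ⟨p, hpX, hpd⟩ := hX.exists_infDist_eq_dist hne (flow f u x)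
    set η : ℝ := (r - L * d u) / 2 with hη
    have hηpos : 0 < η := by simp only [hη]; linarith [show (L : ℝ) * d u < r from hr]
    have h1 := eventually_infDist_flow_le hf hXb hfX hpX hηpos
    have hexp : HasDerivAt (fun s => d u * Real.exp (L * s)) (L * d u) 0 := by
      have := (((hasDerivAt_id (0 : ℝ)).const_mul (L : ℝ)).exp).const_mul (d u)
      simpa [mul_comm] using this
    have h2 : ∀ᶠ s in 𝓝[>] (0 : ℝ), slope (fun s => d u * Real.exp (L * s)) 0 s < L * d u + η :=
      (hexp.hasDerivWithinAt (s := Ioi 0)).limsup_slope_le' (by simp) (by linarith)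
    refine Eventually.frequently ?_
    have hshift : Tendsto (fun z => z - u) (𝓝[>] u) (𝓝[>] 0) := by
      refine tendsto_nhdsWithin_iff.2 ⟨?_, ?_⟩
      · have : Tendsto (fun z => z - u) (𝓝 u) (𝓝 (u - u)) := (continuous_sub_right u).tendsto u
        rw [sub_self] at this
        exact this.mono_left nhdsWithin_le_nhds
      · filter_upwards [self_mem_nhdsWithin] with z hz
        exact sub_pos.2 (mem_Ioi.1 hz)
    filter_upwards [hshift.eventually (h1.and h2), self_mem_nhdsWithin] with z hz hzu
    obtain ⟨hz1, hz2⟩ := hz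
    have hs : 0 < z - u := sub_pos.2 hzu
    rw [slope_def_field, sub_zero, div_lt_iff₀ hs, mul_zero, Real.exp_zero, mul_one] at hz2
    have h3 : d z ≤ Metric.infDist (flow f (z - u) p) X +
        dist (flow f (z - u) (flow f u x)) (flow f (z - u) p) := by
      simp only [hd]
      rw [show flow f z x = flow f (z - u) (flow f u x) by rw [← flow_add hf, sub_add_cancel]]
      exact Metric.infDist_le_infDist_add_dist
    have h4 := dist_flow_le hf hs.le (flow f u x) p
    rw [← hpd] at h4
    rw [inv_mul_lt_iff₀ hs]
    have h5 : (L * d u + η) * (z - u) + η * (z - u) = (z - u) * r := by simp only [hη]; ring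
    simp only [hd] at *
    linarith
  · simp [hd, flow_zero hf, Metric.infDist_zero_of_mem hx]

theorem IsTangentialTo.neg (hfX : IsTangentialTo f X) : IsTangentialTo (fun x => -f x) X :=
  fun p hp ν hν => by rw [inner_neg_left, hfX p hp ν hν, neg_zero]

/-- Negative times are positive times for -f, which is tangential as well. -/
theorem flow_mem (hf : LipschitzWith L f) (hX : IsCompact X)
    (hXb : HasDifferentiableBoundary X) (hfX : IsTangentialTo f X)
    {x : EuclideanSpace ℝ (Fin n)} (hx : x ∈ X) (t : ℝ) : flow f t x ∈ X := by
  rcases le_total 0 t with h | h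
  · exact flow_mem_of_nonneg hf hX hXb hfX hx h
  · have hf' : LipschitzWith L (fun y => -f y) := hf.neg
    have := flow_mem_of_nonneg hf' hX hXb hfX.neg hx (neg_nonneg.2 h)
    rwa [flow_neg hf, neg_neg] at this

end Invariance

/-! ### Distortion of the initial distribution by the flow -/

section Distortion

/-- A `K`-Lipschitz map of `ℝⁿ` increases volumes at most by the factor `Kⁿ`. -/
theorem LipschitzWith.volume_image_le {n : ℕ}
    {S : EuclideanSpace ℝ (Fin n) → EuclideanSpace ℝ (Fin n)} {K : ℝ≥0} (hS : LipschitzWith K S)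
    (A : Set (EuclideanSpace ℝ (Fin n))) :
    volume (S '' A) ≤ (K : ℝ≥0∞) ^ n * volume A := by
  -- Lipschitz maps are easily controlled for Hausdorff measure, and by translation invariance
  -- volume is a multiple of it.
  have hvol := Measure.isAddLeftInvariant_eq_smul
    (volume : Measure (EuclideanSpace ℝ (Fin n))) (Measure.hausdorffMeasure n)
  have h := hS.hausdorffMeasure_image_le (d := n) (Nat.cast_nonneg n) A
  rw [ENNReal.rpow_natCast] at h
  rw [hvol, Measure.smul_apply, Measure.smul_apply, ENNReal.smul_def, ENNReal.smul_def,
    smul_eq_mul, smul_eq_mul, mul_left_comm]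
  gcongr

variable {n : ℕ} {f : EuclideanSpace ℝ (Fin n) → EuclideanSpace ℝ (Fin n)} {L : ℝ≥0}
  {X : Set (EuclideanSpace ℝ (Fin n))}

/-- A measure with a continuous positive density on a compact set is comparable to the restricted
Lebesgue measure. -/
theorem exists_bounds_withDensity {E : Type*} [TopologicalSpace E] [T2Space E] [MeasurableSpace E]
    [BorelSpace E] (ν : Measure E) {X : Set E} (hX : IsCompact X) {φ : E → ℝ}
    (hφ : ContinuousOn φ X) (hpos : ∀ x ∈ X, 0 < φ x) :
    ∃ c C : ℝ≥0, 0 < c ∧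
      (c : ℝ≥0∞) • ν.restrict X ≤ (ν.restrict X).withDensity (fun x => ENNReal.ofReal (φ x)) ∧
      (ν.restrict X).withDensity (fun x => ENNReal.ofReal (φ x)) ≤ (C : ℝ≥0∞) • ν.restrict X := by
  rcases X.eq_empty_or_nonempty with rfl | hne
  · exact ⟨1, 1, one_pos, by simp, by simp⟩
  obtain ⟨a, haX, ha⟩ := hX.exists_isMinOn hne hφ
  obtain ⟨b, hbX, hb⟩ := hX.exists_isMaxOn hne hφ
  refine ⟨(φ a).toNNReal, (φ b).toNNReal, by simpa using hpos a haX, ?_, ?_⟩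
  · rw [← withDensity_const]
    refine withDensity_mono ?_
    filter_upwards [ae_restrict_mem hX.measurableSet] with x hx
    exact ENNReal.ofReal_le_ofReal (ha hx)
  · rw [← withDensity_const]
    refine withDensity_mono ?_
    filter_upwards [ae_restrict_mem hX.measurableSet] with x hx
    exact ENNReal.ofReal_le_ofReal (hb hx)

/-- Expectations over initial conditions are controlled by expectations over the states at
time `t`. -/
theorem exists_lintegral_le_lintegral_flow (hf : LipschitzWith L f) (hX : IsCompact X)
    (hXb : HasDifferentiableBoundary X) (hfX : IsTangentialTo f X)
    {fμ : EuclideanSpace ℝ (Fin n) → ℝ} (hfμ : ContinuousOn fμ X) (hfμpos : ∀ x ∈ X, 0 < fμ x)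
    {μ : Measure (EuclideanSpace ℝ (Fin n))}
    (hμ : μ = (volume.restrict X).withDensity fun x => ENNReal.ofReal (fμ x)) (t : ℝ) :
    ∃ C : ℝ≥0, ∀ φ : EuclideanSpace ℝ (Fin n) → ℝ≥0∞,
      ∫⁻ x, φ x ∂μ ≤ C * ∫⁻ x, φ (flow f t x) ∂μ := by
  obtain ⟨c, C, hc, hcμ, hμC⟩ := exists_bounds_withDensity volume hX hfμ hfμpos
  rw [← hμ] at hcμ hμC
  set K : ℝ≥0 := (Real.exp (L * |t|)).toNNReal
  set e := (flowHomeomorph hf t).toMeasurableEquiv with he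
  -- The density bounds turn μ into volume on X and back. In between, A ∩ X is the S_t-image of
  -- points of X, by invariance under S_{-t}, and S_t expands volumes at most by Kⁿ.
  have hle : μ ≤ ((C * K ^ n * c⁻¹ : ℝ≥0) : ℝ≥0∞) • μ.map e := by
    refine Measure.le_iff.2 fun A hA => ?_
    rw [Measure.smul_apply, smul_eq_mul, e.map_apply]
    have h1 : μ A ≤ C * volume (A ∩ X) := by
      refine (hμC A).trans ?_
      rw [Measure.smul_apply, smul_eq_mul, Measure.restrict_apply hA]
    have himg : A ∩ X ⊆ flow f t '' (e ⁻¹' A ∩ X) := by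
      rintro x ⟨hxA, hxX⟩
      have hx : flow f t (flow f (-t) x) = x := by
        rw [← flow_add hf, add_neg_cancel, flow_zero hf]
      refine ⟨flow f (-t) x, ⟨?_, flow_mem hf hX hXb hfX hxX _⟩, hx⟩
      change flow f t (flow f (-t) x) ∈ A
      rwa [hx]
    have h2 : volume (A ∩ X) ≤ (K : ℝ≥0∞) ^ n * volume (e ⁻¹' A ∩ X) :=
      (measure_mono himg).trans ((lipschitzWith_flow hf t).volume_image_le _)
    have h3 : volume (e ⁻¹' A ∩ X) ≤ (c : ℝ≥0∞)⁻¹ * μ (e ⁻¹' A) := by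
      have := hcμ (e ⁻¹' A)
      rw [Measure.smul_apply, smul_eq_mul, Measure.restrict_apply (e.measurable hA)] at this
      rwa [mul_comm, ← div_eq_mul_inv, ENNReal.le_div_iff_mul_le (by simp [hc.ne']) (by simp),
        mul_comm]
    calc μ A ≤ C * ((K : ℝ≥0∞) ^ n * ((c : ℝ≥0∞)⁻¹ * μ (e ⁻¹' A))) := by
          refine h1.trans ?_
          gcongr
          refine h2.trans ?_
          gcongr
      _ = ((C * K ^ n * c⁻¹ : ℝ≥0) : ℝ≥0∞) * μ (e ⁻¹' A) := by
          push_cast [ENNReal.coe_inv hc.ne']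
          ring
  refine ⟨C * K ^ n * c⁻¹, fun φ => ?_⟩
  calc ∫⁻ x, φ x ∂μ ≤ ∫⁻ x, φ x ∂(((C * K ^ n * c⁻¹ : ℝ≥0) : ℝ≥0∞) • μ.map e) :=
        lintegral_mono' hle le_rfl
    _ = _ := by
        -- The change of variables along a measurable embedding holds for every `φ`, measurable or
        -- not.
        rw [lintegral_smul_measure, e.measurableEmbedding.lintegral_map, smul_eq_mul]
        rfl

end Distortion

/-! ### Universal approximation with a Lipschitz activation that is not affine -/

section UniversalApproximation

open Filter Topology

/-- Closed subspaces contain the integrals of their compactly supported continuous families. -/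
theorem Submodule.integral_mem_of_isClosed {E : Type*} [NormedAddCommGroup E] [NormedSpace ℝ E]
    [CompleteSpace E] {S : Submodule ℝ E} (hS : IsClosed (S : Set E)) {F : ℝ → E}
    (hF : Continuous F) (hc : HasCompactSupport F) (hmem : ∀ s, F s ∈ S) : ∫ s, F s ∈ S := by
  have : CompleteSpace S := hS.completeSpace_coe
  have hF' : Continuous fun s => (⟨F s, hmem s⟩ : S) := hF.subtype_mk _
  have hc' : HasCompactSupport fun s => (⟨F s, hmem s⟩ : S) := by
    refine hc.mono fun s hs h => hs ?_
    exact Subtype.ext h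
  have := S.subtypeL.integral_comp_comm (hF'.integrable_of_hasCompactSupport hc' (μ := volume))
  have h2 : ∫ s, F s = ((∫ s, (⟨F s, hmem s⟩ : S) : S) : E) := this
  rw [h2]
  exact Subtype.mem _

/-- Closed subspaces contain the derivatives of their differentiable curves. -/
theorem Submodule.hasDerivAt_mem_of_isClosed {E : Type*} [NormedAddCommGroup E] [NormedSpace ℝ E]
    {S : Submodule ℝ E} (hS : IsClosed (S : Set E)) {F : ℝ → E} {F' : E} {a : ℝ}
    (hF : HasDerivAt F F' a) (hmem : ∀ s, F s ∈ S) : F' ∈ S := by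
  refine hS.mem_of_tendsto (hasDerivAt_iff_tendsto_slope.1 hF) (Eventually.of_forall fun s => ?_)
  rw [slope_def_module]
  exact S.smul_mem _ (S.sub_mem (hmem s) (hmem a))

variable {Y : Type*} [TopologicalSpace Y] [CompactSpace Y]

/-- The function `y ↦ τ (a u(y) + b)`. -/
noncomputable def ridge (τ : C(ℝ, ℝ)) (u : C(Y, ℝ)) (a b : ℝ) : C(Y, ℝ) :=
  τ.comp (a • u + ContinuousMap.const Y b)

omit [CompactSpace Y] in
@[simp] theorem ridge_apply (τ : C(ℝ, ℝ)) (u : C(Y, ℝ)) (a b : ℝ) (y : Y) :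
    ridge τ u a b y = τ (a * u y + b) := rfl

theorem continuous_ridge (τ : C(ℝ, ℝ)) (u : C(Y, ℝ)) :
    Continuous fun p : ℝ × ℝ => ridge τ u p.1 p.2 := by
  refine (ContinuousMap.continuous_postcomp τ).comp ?_
  refine (continuous_fst.smul continuous_const).add ?_
  exact ContinuousMap.continuous_const'.comp continuous_snd

/-- The derivative is taken in the sup norm. A pointwise computation shows that the curve is the
integral of a continuous C(Y, ℝ)-valued function, which replaces a uniform remainder estimate. -/
theorem hasDerivAt_mul_ridge {τ τ' : C(ℝ, ℝ)} (hτ : ∀ x, HasDerivAt τ (τ' x) x)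
    (v u : C(Y, ℝ)) (b a : ℝ) :
    HasDerivAt (fun a => v * ridge τ u a b) (v * u * ridge τ' u a b) a := by
  set G : ℝ → C(Y, ℝ) := fun s => v * u * ridge τ' u s b with hG
  have hGc : Continuous G :=
    continuous_const.mul ((continuous_ridge τ' u).comp (continuous_id.prodMk continuous_const))
  have hint : ∀ c, v * ridge τ u c b = v * ridge τ u 0 b + ∫ s in (0 : ℝ)..c, G s := by
    intro c
    ext y
    have h1 : (∫ s in (0 : ℝ)..c, G s) y = ∫ s in (0 : ℝ)..c, G s y :=
      ((ContinuousMap.evalCLM ℝ y).intervalIntegral_comp_comm (hGc.intervalIntegrable 0 c)).symm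
    have h2 : ∫ s in (0 : ℝ)..c, G s y = v y * τ (c * u y + b) - v y * τ (0 * u y + b) := by
      refine intervalIntegral.integral_eq_sub_of_hasDerivAt
        (f := fun s => v y * τ (s * u y + b)) (fun s _ => ?_) ?_
      · have h3 : HasDerivAt (fun s : ℝ => s * u y + b) (u y) s := by
          simpa using ((hasDerivAt_id s).mul_const (u y)).add_const b
        have := ((hτ (s * u y + b)).comp s h3).const_mul (v y)
        refine this.congr_deriv ?_
        simp [hG]; ring
      · exact ((ContinuousMap.evalCLM ℝ y).continuous.comp hGc).intervalIntegrable _ _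
    simp only [ContinuousMap.add_apply, ContinuousMap.mul_apply, ridge_apply, h1, h2]
    ring
  rw [funext hint]
  exact (intervalIntegral.integral_hasDerivAt_right (hGc.intervalIntegrable 0 a)
    hGc.stronglyMeasurable.stronglyMeasurableAtFilter hGc.continuousAt).const_add _

/-- Mollifications of `σ` give ridge functions in the same closed subspaces as `σ`. -/
theorem ridge_convolution_mem {S : Submodule ℝ C(Y, ℝ)} (hS : IsClosed (S : Set C(Y, ℝ)))
    {σ τ : C(ℝ, ℝ)} {φ : ℝ → ℝ} (hφ : Continuous φ) (hφc : HasCompactSupport φ)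
    (hτ : ∀ x, τ x = ∫ s, φ s * σ (x - s)) (u : C(Y, ℝ)) (a b : ℝ)
    (hmem : ∀ b, ridge σ u a b ∈ S) : ridge τ u a b ∈ S := by
  set F : ℝ → C(Y, ℝ) := fun s => φ s • ridge σ u a (b - s) with hF
  have hFc : Continuous F := hφ.smul ((continuous_ridge σ u).comp
    (continuous_const.prodMk (continuous_sub_left b)))
  have hFs : HasCompactSupport F := hφc.smul_right
  have : ridge τ u a b = ∫ s, F s := by
    ext y
    rw [ContinuousMap.integral_apply (hFc.integrable_of_hasCompactSupport hFs)]
    simp [hF, hτ, add_sub_assoc]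
  rw [this]
  exact Submodule.integral_mem_of_isClosed hS hFc hFs fun s => S.smul_mem _ (hmem _)

/-- A smooth activation with nowhere identically vanishing derivatives generates all powers. -/
theorem pow_mem_of_ridge_mem {S : Submodule ℝ C(Y, ℝ)} (hS : IsClosed (S : Set C(Y, ℝ)))
    {τ : ℝ → ℝ} (hτ : ContDiff ℝ (⊤ : ℕ∞) τ) (hne : ∀ j, ∃ b, iteratedDeriv j τ b ≠ 0) (u : C(Y, ℝ))
    (hmem : ∀ a b, ridge ⟨τ, hτ.continuous⟩ u a b ∈ S) (j : ℕ) : u ^ j ∈ S := by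
  have hcont : ∀ j, Continuous (iteratedDeriv j τ) := fun j =>
    hτ.continuous_iteratedDeriv j (by exact_mod_cast le_top)
  -- Every derivative in the scale a brings down a factor u. At a = 0 only a constant multiple of u
  -- ^ j remains, nonzero for a suitable b.
  have hall : ∀ j a b, u ^ j * ridge ⟨iteratedDeriv j τ, hcont j⟩ u a b ∈ S := by
    intro j
    induction j with
    | zero =>
      intro a b
      simpa [iteratedDeriv_zero] using hmem a b
    | succ j ih =>
      intro a b
      have hd : ∀ x, HasDerivAt (⟨iteratedDeriv j τ, hcont j⟩ : C(ℝ, ℝ))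
          ((⟨iteratedDeriv (j + 1) τ, hcont (j + 1)⟩ : C(ℝ, ℝ)) x) x := by
        intro x
        have : DifferentiableAt ℝ (iteratedDeriv j τ) x :=
          (hτ.differentiable_iteratedDeriv j (by exact_mod_cast ENat.natCast_lt_top j)) x
        simpa [iteratedDeriv_succ] using this.hasDerivAt
      have := Submodule.hasDerivAt_mem_of_isClosed hS (hasDerivAt_mul_ridge hd (u ^ j) u b a)
        fun s => ih s b
      rwa [← pow_succ] at this
  obtain ⟨b, hb⟩ := hne j
  have h := S.smul_mem (iteratedDeriv j τ b)⁻¹ (hall j 0 b)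
  convert h using 1
  ext y
  simp
  field_simp

end UniversalApproximation

/-! ### Smoothing the activation function -/

section SmoothActivation

open Filter Topology

theorem exists_eq_add_const_of_deriv_eq {g k : ℝ → ℝ} (hg : Differentiable ℝ g)
    (hk : Differentiable ℝ k) (h : ∀ x, deriv g x = deriv k x) : ∃ c, ∀ x, g x = k x + c := by
  refine ⟨g 0 - k 0, fun x => ?_⟩
  have := is_const_of_deriv_eq_zero (hg.sub hk)
    (fun x => by rw [deriv_sub (hg x) (hk x), h, sub_self]) x 0
  simp only [Pi.sub_apply] at this
  linarith

/-- A smooth function with a vanishing iterated derivative is a polynomial. -/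
theorem exists_polynomial_of_iteratedDeriv_eq_zero (j : ℕ) :
    ∀ {g : ℝ → ℝ}, ContDiff ℝ (⊤ : ℕ∞) g → (∀ x, iteratedDeriv j g x = 0) →
      ∃ q : Polynomial ℝ, ∀ x, g x = q.eval x := by
  induction j with
  | zero => exact fun _ h => ⟨0, by simpa using h⟩
  | succ j ih =>
    intro g hg h
    have hg' : ContDiff ℝ (⊤ : ℕ∞) (deriv g) := (contDiff_infty_iff_deriv.1 hg).2
    obtain ⟨q, hq⟩ := ih hg' fun x => by rw [← iteratedDeriv_succ']; exact h x
    obtain ⟨Q, hQ⟩ : ∃ Q : Polynomial ℝ, Polynomial.derivative Q = q := by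
      clear hq
      induction q using Polynomial.induction_on' with
      | add p q hp hq =>
        obtain ⟨P, rfl⟩ := hp
        obtain ⟨Q, rfl⟩ := hq
        exact ⟨P + Q, Polynomial.derivative_add⟩
      | monomial n a =>
        refine ⟨Polynomial.monomial (n + 1) (a / (n + 1)), ?_⟩
        rw [Polynomial.derivative_monomial]
        congr 1
        push_cast
        field_simp
    obtain ⟨c, hc⟩ := exists_eq_add_const_of_deriv_eq (hg.differentiable (by simp))
      Q.differentiable fun x => by rw [hq, Polynomial.deriv, hQ]
    exact ⟨Q + Polynomial.C c, fun x => by simpa using hc x⟩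

/-- A Lipschitz smooth function with a vanishing iterated derivative is affine. -/
theorem affine_of_iteratedDeriv_eq_zero {g : ℝ → ℝ} {K : ℝ≥0} (hg : ContDiff ℝ (⊤ : ℕ∞) g)
    (hK : LipschitzWith K g) {j : ℕ} (h : ∀ x, iteratedDeriv j g x = 0) :
    ∃ a b : ℝ, ∀ x, g x = a * x + b := by
  obtain ⟨q, hq⟩ := exists_polynomial_of_iteratedDeriv_eq_zero j hg h
  have hder : ∀ x, deriv g x = q.derivative.eval x := fun x => by
    rw [funext hq, Polynomial.deriv]
  -- The Lipschitz constant bounds the derivative, and a bounded polynomial is constant.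
  have hbdd : q.derivative.degree ≤ 0 := by
    rw [← Polynomial.isBoundedUnder_abs_atTop_iff]
    refine ⟨K, eventually_map.2 (Eventually.of_forall fun x => ?_)⟩
    rw [← hder, ← Real.norm_eq_abs]
    exact norm_deriv_le_of_lipschitz hK
  have hlin : ∀ x, deriv (fun x => q.derivative.coeff 0 * x) x = q.derivative.coeff 0 := fun x => by
    simp
  obtain ⟨c, hc⟩ := exists_eq_add_const_of_deriv_eq (hg.differentiable (by simp))
    (differentiable_id.const_mul (q.derivative.coeff 0)) fun x => by
      simp only [id]
      rw [hlin, hder, Polynomial.eq_C_of_degree_le_zero hbdd]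
      simp
  exact ⟨_, c, hc⟩

/-- A Lipschitz function that is not affine has a smooth Lipschitz mollification that is not
affine. -/
theorem exists_smooth_mollification {σ : ℝ → ℝ} {K : ℝ≥0} (hσ : LipschitzWith K σ)
    (hna : ¬ ∃ a b : ℝ, ∀ x, σ x = a * x + b) :
    ∃ φ τ : ℝ → ℝ, Continuous φ ∧ HasCompactSupport φ ∧ ContDiff ℝ (⊤ : ℕ∞) τ ∧
      LipschitzWith K τ ∧ (∀ x, τ x = ∫ s, φ s * σ (x - s)) ∧
      ¬ ∃ a b : ℝ, ∀ x, τ x = a * x + b := by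
  set B : ℕ → ContDiffBump (0 : ℝ) := fun i =>
    ⟨1 / (2 * ((i : ℝ) + 1)), 1 / ((i : ℝ) + 1), by positivity, by
      rw [div_lt_div_iff_of_pos_left one_pos (by positivity) (by positivity)]
      linarith [(Nat.cast_nonneg i : (0 : ℝ) ≤ i)]⟩ with hB
  set τ : ℕ → ℝ → ℝ := fun i x => ∫ s, (B i).normed volume s * σ (x - s) with hτ
  have hconv : ∀ i, τ i = MeasureTheory.convolution ((B i).normed volume) σ
      (ContinuousLinearMap.lsmul ℝ ℝ) volume := by
    intro i
    funext x
    simp [hτ, convolution_def]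
  have hlim : ∀ x, Tendsto (fun i => τ i x) atTop (𝓝 (σ x)) := by
    intro x
    simp_rw [hconv]
    refine ContDiffBump.convolution_tendsto_right_of_continuous ?_ hσ.continuous x
    exact tendsto_one_div_add_atTop_nhds_zero_nat
  -- An affine function is determined by its values at 0 and 1, so a pointwise limit of affine
  -- functions is affine.
  obtain ⟨i, hi⟩ : ∃ i, ¬ ∃ a b : ℝ, ∀ x, τ i x = a * x + b := by
    by_contra! hcon
    refine hna ⟨σ 1 - σ 0, σ 0, fun x => ?_⟩
    have heq : ∀ i, τ i x = (τ i 1 - τ i 0) * x + τ i 0 := by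
      intro i
      obtain ⟨a, b, hab⟩ := hcon i
      simp only [hab]; ring
    have h2 := (((hlim 1).sub (hlim 0)).mul_const x).add (hlim 0)
    exact tendsto_nhds_unique (hlim x) (h2.congr fun i => (heq i).symm)
  have hint : ∀ x, Integrable fun s => (B i).normed volume s * σ (x - s) := fun x =>
    (((B i).continuous_normed).mul (hσ.continuous.comp (continuous_sub_left x))
      ).integrable_of_hasCompactSupport ((B i).hasCompactSupport_normed.mul_right)
  refine ⟨(B i).normed volume, τ i, (B i).continuous_normed, (B i).hasCompactSupport_normed,
    ?_, ?_, fun x => rfl, hi⟩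
  · rw [hconv]
    exact (B i).hasCompactSupport_normed.contDiff_convolution_left _ (B i).contDiff_normed
      hσ.continuous.locallyIntegrable
  · refine LipschitzWith.of_dist_le_mul fun x y => ?_
    rw [Real.dist_eq, hτ]
    simp only
    rw [← integral_sub (hint x) (hint y), ← Real.norm_eq_abs]
    have hb : ∀ s, ‖(B i).normed volume s * σ (x - s) - (B i).normed volume s * σ (y - s)‖ ≤
        (B i).normed volume s * (K * dist x y) := by
      intro s
      rw [← mul_sub, norm_mul, Real.norm_of_nonneg ((B i).nonneg_normed s)]
      gcongr
      · exact (B i).nonneg_normed s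
      · have := hσ.dist_le_mul (x - s) (y - s)
        rwa [dist_sub_right, Real.dist_eq] at this
    refine (norm_integral_le_of_norm_le ?_ (Eventually.of_forall hb)).trans ?_
    · exact (B i).integrable_normed.mul_const _
    · rw [integral_mul_const, (B i).integral_normed, one_mul]

end SmoothActivation

/-! ### Density of ridge functions by Stone–Weierstrass -/

section Density

open Filter Topology

variable {Y : Type*} [TopologicalSpace Y] [CompactSpace Y]

/-- The ridge functions `σ (u + b)`, where `u` runs through a point separating space of
functions, span a dense subspace of `C(Y, ℝ)`. -/
theorem span_ridge_dense {σ : C(ℝ, ℝ)} {K : ℝ≥0} (hσ : LipschitzWith K σ)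
    (hna : ¬ ∃ a b : ℝ, ∀ x, σ x = a * x + b) (V : Submodule ℝ C(Y, ℝ))
    (hV : ∀ x y : Y, x ≠ y → ∃ u ∈ V, u x ≠ u y) :
    (Submodule.span ℝ {v | ∃ u ∈ V, ∃ b, v = ridge σ u 1 b}).topologicalClosure = ⊤ := by
  set S := (Submodule.span ℝ {v | ∃ u ∈ V, ∃ b, v = ridge σ u 1 b}).topologicalClosure with hSdef
  have hS : IsClosed (S : Set C(Y, ℝ)) := Submodule.isClosed_topologicalClosure _
  obtain ⟨φ, τ, hφ, hφc, hτ, hτL, hτσ, hτna⟩ := exists_smooth_mollification hσ hna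
  have h1 : ∀ u ∈ V, ∀ a b, ridge ⟨τ, hτ.continuous⟩ u a b ∈ S := by
    intro u hu a b
    refine ridge_convolution_mem hS hφ hφc hτσ u a b fun b => ?_
    refine Submodule.le_topologicalClosure _ (Submodule.subset_span ⟨a • u, V.smul_mem a hu, b, ?_⟩)
    ext y
    simp
  have h2 : ∀ j, ∃ b, iteratedDeriv j τ b ≠ 0 := by
    intro j
    by_contra! h
    exact hτna (affine_of_iteratedDeriv_eq_zero hτ hτL h)
  have h3 : ∀ u ∈ V, ∀ j : ℕ, u ^ j ∈ S := fun u hu j =>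
    pow_mem_of_ridge_mem hS hτ h2 u (h1 u hu) j
  -- Powers of a single u do not give products of different ones. Exponentials do, as exp u · exp v
  -- = exp (u + v), so their span is already an algebra.
  have h4 : ∀ u ∈ V, NormedSpace.exp u ∈ S := by
    intro u hu
    refine hS.mem_of_tendsto (NormedSpace.exp_series_hasSum_exp' (𝕂 := ℝ) u)
      (Eventually.of_forall fun s => ?_)
    exact S.sum_mem fun j _ => S.smul_mem _ (h3 u hu j)
  set P : Submonoid C(Y, ℝ) :=
    { carrier := {v | ∃ u ∈ V, v = NormedSpace.exp u}
      one_mem' := ⟨0, V.zero_mem, NormedSpace.exp_zero.symm⟩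
      mul_mem' := by
        rintro _ _ ⟨u, hu, rfl⟩ ⟨v, hv, rfl⟩
        exact ⟨u + v, V.add_mem hu hv, NormedSpace.exp_add.symm⟩ } with hP
  have h5 : ((Algebra.adjoin ℝ (P : Set C(Y, ℝ))).topologicalClosure) = ⊤ := by
    refine ContinuousMap.subalgebra_topologicalClosure_eq_top_of_separatesPoints _ ?_
    intro x y hxy
    obtain ⟨u, hu, hne⟩ := hV x y hxy
    have hev : ∀ z, (NormedSpace.exp u : C(Y, ℝ)) z = Real.exp (u z) := by
      intro z
      have := NormedSpace.map_exp (ContinuousMap.evalAlgHom ℝ ℝ z) 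
        (ContinuousMap.evalCLM ℝ z).continuous u
      rw [Real.exp_eq_exp_ℝ]
      exact this
    refine ⟨_, ⟨NormedSpace.exp u, Algebra.subset_adjoin ⟨u, hu, rfl⟩, rfl⟩, ?_⟩
    simp only [hev]
    exact fun h => hne (Real.exp_injective h)
  have h6 : ((Algebra.adjoin ℝ (P : Set C(Y, ℝ)) : Subalgebra ℝ C(Y, ℝ)) : Set C(Y, ℝ)) ⊆ S := by
    intro v hv
    have hv' : v ∈ Subalgebra.toSubmodule (Algebra.adjoin ℝ (P : Set C(Y, ℝ))) := hv
    rw [Algebra.adjoin_eq_span, Submonoid.closure_eq] at hv'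
    refine Submodule.span_le.2 ?_ hv'
    rintro _ ⟨u, hu, rfl⟩
    exact h4 u hu
  rw [eq_top_iff]
  intro v _
  have : v ∈ (Algebra.adjoin ℝ (P : Set C(Y, ℝ))).topologicalClosure := by rw [h5]; trivial
  exact closure_minimal h6 hS this

end Density

/-! ### Networks with one hidden layer -/

section Networks

open Filter Topology

theorem EuclideanSpace.norm_le_sum_abs {q : ℕ} (v : EuclideanSpace ℝ (Fin q)) :
    ‖v‖ ≤ ∑ i, |v i| := by
  refine abs_le_of_sq_le_sq' ?_ (Finset.sum_nonneg fun i _ => abs_nonneg _) |>.2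
  rw [EuclideanSpace.norm_sq_eq]
  simp only [Real.norm_eq_abs]
  exact Finset.sum_sq_le_sq_sum_of_nonneg fun i _ => abs_nonneg _

variable {σ : ℝ → ℝ} {Lσ : ℝ≥0} {k m q W D : ℕ}

theorem toFun_apply (θ : NetWeights (Fin k × Fin m) (Fin q) W 0)
    (y : Fin k → EuclideanSpace ℝ (Fin m)) (i : Fin q) :
    θ.toFun σ y i =
      (∑ j, θ.2.2.1 i j * σ ((∑ p, θ.1.1 j p * y p.1 p.2) + θ.1.2 j)) + θ.2.2.2 i := rfl

theorem continuous_toFun (hσ : Continuous σ) :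
    Continuous fun p : NetWeights (Fin k × Fin m) (Fin q) W 0 ×
      (Fin k → EuclideanSpace ℝ (Fin m)) => p.1.toFun σ p.2 := by
  refine (PiLp.continuous_toLp 2 _).comp (continuous_pi fun i => ?_)
  simp only [NetWeights.eval, AffineLayer.apply, hiddenLayers]
  fun_prop

theorem AffineLayer.isCompact_boundedBy (ι κ : Type) [Fintype ι] [Fintype κ] (M : ℝ) :
    IsCompact {a : AffineLayer ι κ | a.BoundedBy M} := by
  have h1 : IsCompact (Set.univ.pi fun _ : κ => Set.univ.pi fun _ : ι => Icc (-M) M) :=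
    isCompact_univ_pi fun _ => isCompact_univ_pi fun _ => isCompact_Icc
  have h2 : IsCompact (Set.univ.pi fun _ : κ => Icc (-M) M) :=
    isCompact_univ_pi fun _ => isCompact_Icc
  have heq : {a : AffineLayer ι κ | a.BoundedBy M} =
      (Set.univ.pi fun _ : κ => Set.univ.pi fun _ : ι => Icc (-M) M) ×ˢ
        (Set.univ.pi fun _ : κ => Icc (-M) M) := by
    ext a
    exact ⟨fun h => ⟨fun i _ j _ => abs_le.1 (h.1 i j), fun i _ => abs_le.1 (h.2 i)⟩,
      fun h => ⟨fun i j => abs_le.2 (h.1 i trivial j trivial), fun i => abs_le.2 (h.2 i trivial)⟩⟩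
  rw [heq]
  exact h1.prod h2

theorem isCompact_setOf_boundedBy (ι κ : Type) [Fintype ι] [Fintype κ] (W D : ℕ) (M : ℝ) :
    IsCompact {θ : NetWeights ι κ W D | θ.BoundedBy M} := by
  have h := (AffineLayer.isCompact_boundedBy ι (Fin W) M).prod
    ((isCompact_univ_pi fun _ : Fin D => AffineLayer.isCompact_boundedBy (Fin W) (Fin W) M).prod
      (AffineLayer.isCompact_boundedBy (Fin W) κ M))
  have heq : {θ : NetWeights ι κ W D | θ.BoundedBy M} =
      {a : AffineLayer ι (Fin W) | a.BoundedBy M} ×ˢ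
        ((Set.univ.pi fun _ : Fin D => {a : AffineLayer (Fin W) (Fin W) | a.BoundedBy M}) ×ˢ
          {a : AffineLayer (Fin W) κ | a.BoundedBy M}) := by
    ext a
    simp [NetWeights.BoundedBy, Set.mem_pi]
  rw [heq]
  exact h

theorem AffineLayer.exists_boundedBy {ι κ : Type} [Fintype ι] [Fintype κ] (a : AffineLayer ι κ) :
    ∃ M, ∀ M' ≥ M, a.BoundedBy M' := by
  obtain ⟨M₁, h₁⟩ := Finite.exists_le fun p : κ × ι => |a.1 p.1 p.2|
  obtain ⟨M₂, h₂⟩ := Finite.exists_le fun i => |a.2 i|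
  exact ⟨max M₁ M₂, fun M' hM => ⟨fun i j => (h₁ (i, j)).trans ((le_max_left _ _).trans hM),
    fun i => (h₂ i).trans ((le_max_right _ _).trans hM)⟩⟩

/-- Networks with bounded weights are Lipschitz with a common constant. -/
theorem exists_lipschitz_toFun (hσ : LipschitzWith Lσ σ) (k m q W : ℕ) {M : ℝ} (hM : 0 < M) :
    ∃ Λ : ℝ, 0 ≤ Λ ∧ ∀ η ∈ networkClass σ k m q W 0 M,
      ∀ y y' : Fin k → EuclideanSpace ℝ (Fin m), ‖η y - η y'‖ ≤ Λ * ‖y - y'‖ := by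
  refine ⟨∑ _i : Fin q, ∑ _j : Fin W, M * (Lσ * ∑ _p : Fin k × Fin m, M), by positivity, ?_⟩
  rintro _ ⟨θ, ⟨⟨h1, -⟩, -, ⟨h2, -⟩⟩, rfl⟩ y y'
  refine (EuclideanSpace.norm_le_sum_abs _).trans ?_
  rw [Finset.sum_mul]
  refine Finset.sum_le_sum fun i _ => ?_
  rw [PiLp.sub_apply, toFun_apply, toFun_apply, add_sub_add_right_eq_sub,
    ← Finset.sum_sub_distrib, Finset.sum_mul]
  refine (Finset.abs_sum_le_sum_abs _ _).trans (Finset.sum_le_sum fun j _ => ?_)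
  rw [← mul_sub, abs_mul, mul_assoc]
  refine mul_le_mul (h2 i j) ?_ (abs_nonneg _) hM.le
  refine (hσ.dist_le_mul _ _).trans ?_
  rw [mul_assoc]
  refine mul_le_mul_of_nonneg_left ?_ Lσ.coe_nonneg
  rw [Real.dist_eq, add_sub_add_right_eq_sub, ← Finset.sum_sub_distrib, Finset.sum_mul]
  refine (Finset.abs_sum_le_sum_abs _ _).trans (Finset.sum_le_sum fun p _ => ?_)
  rw [← mul_sub, abs_mul]
  refine mul_le_mul (h1 j p) ?_ (abs_nonneg _) hM.le
  calc |y p.1 p.2 - y' p.1 p.2| = ‖(y p.1 - y' p.1) p.2‖ := by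
        rw [Real.norm_eq_abs, PiLp.sub_apply]
    _ ≤ ‖y p.1 - y' p.1‖ := PiLp.norm_apply_le _ _
    _ ≤ ‖y - y'‖ := norm_le_pi_norm (y - y') p.1

/-- The coordinate functions on a set of token sequences. -/
noncomputable def tokenCoord (Q : Set (Fin k → EuclideanSpace ℝ (Fin m))) (p : Fin k × Fin m) :
    C(Q, ℝ) :=
  ⟨fun y => y.1 p.1 p.2, (EuclideanSpace.proj (𝕜 := ℝ) p.2).continuous.comp
    ((continuous_apply p.1).comp continuous_subtype_val)⟩

/-- The linear combinations of token coordinates separate the points of Q, and the ridge functions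
over them are exactly the neurons of the hidden layer. -/
theorem exists_sum_ridge_approx (hσ : LipschitzWith Lσ σ)
    (hna : ¬ ∃ a b : ℝ, ∀ x, σ x = a * x + b) {Q : Set (Fin k → EuclideanSpace ℝ (Fin m))}
    (hQ : IsCompact Q) {γ : (Fin k → EuclideanSpace ℝ (Fin m)) → ℝ} (hγ : ContinuousOn γ Q)
    {ε : ℝ} (hε : 0 < ε) :
    ∃ (N : ℕ) (c b : Fin N → ℝ) (w : Fin N → Fin k × Fin m → ℝ), ∀ y ∈ Q,
      |(∑ j, c j * σ ((∑ p, w j p * y p.1 p.2) + b j)) - γ y| < ε := by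
  have : CompactSpace Q := isCompact_iff_compactSpace.1 hQ
  set V : Submodule ℝ C(Q, ℝ) := (Fintype.linearCombination ℝ (tokenCoord Q)).range with hV
  have hsep : ∀ x y : Q, x ≠ y → ∃ u ∈ V, u x ≠ u y := by
    intro x y hxy
    by_contra! h
    refine hxy (Subtype.ext (funext fun i => PiLp.ext fun l => ?_))
    refine h (tokenCoord Q (i, l)) ⟨Pi.single (i, l) 1, ?_⟩
    simp
  have hdense := span_ridge_dense (σ := ⟨σ, hσ.continuous⟩) hσ hna V hsep
  have hmem : (⟨Q.domRestrict γ, hγ.domRestrict⟩ : C(Q, ℝ)) ∈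
      (Submodule.span ℝ {v | ∃ u ∈ V, ∃ b, v = ridge ⟨σ, hσ.continuous⟩ u 1 b}).topologicalClosure :=
    hdense ▸ Submodule.mem_top
  obtain ⟨v, hv, hdist⟩ := Metric.mem_closure_iff.1 hmem ε hε
  obtain ⟨N, c, g, rfl⟩ := Submodule.mem_span_set'.1 hv
  choose u hu b hb using fun j => (g j).2
  choose w hw using hu
  refine ⟨N, c, b, w, fun y hy => ?_⟩
  have := (ContinuousMap.dist_apply_le_dist (⟨y, hy⟩ : Q)).trans_lt hdist
  rw [dist_comm, Real.dist_eq] at this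
  refine lt_of_eq_of_lt (congrArg abs (congrArg₂ _ ?_ rfl)) this
  rw [ContinuousMap.coe_sum, Finset.sum_apply]
  refine Finset.sum_congr rfl fun j _ => ?_
  rw [ContinuousMap.smul_apply, hb j, ridge_apply, ← hw j, Fintype.linearCombination_apply,
    ContinuousMap.coe_sum, Finset.sum_apply, one_mul]
  rfl

/-- Networks with one hidden layer are dense in the continuous functions on compact sets. -/
theorem exists_network_approx (hσ : LipschitzWith Lσ σ)
    (hna : ¬ ∃ a b : ℝ, ∀ x, σ x = a * x + b) {Q : Set (Fin k → EuclideanSpace ℝ (Fin m))}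
    (hQ : IsCompact Q) {γ : (Fin k → EuclideanSpace ℝ (Fin m)) → EuclideanSpace ℝ (Fin q)}
    (hγ : ContinuousOn γ Q) {ε : ℝ} (hε : 0 < ε) :
    ∃ (W : ℕ) (M : ℝ), 0 < M ∧ ∃ η ∈ networkClass σ k m q W 0 M, ∀ y ∈ Q, ‖η y - γ y‖ ≤ ε := by
  have hε' : 0 < ε / (q + 1) := by positivity
  have hγi : ∀ i, ContinuousOn (fun y => γ y i) Q := fun i =>
    (EuclideanSpace.proj (𝕜 := ℝ) i).continuous.comp_continuousOn hγ
  choose N c b w h using fun i => exists_sum_ridge_approx hσ hna hQ (hγi i) hε'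
  -- Each output coordinate gets its own block of neurons, and the output weights vanish outside
  -- that block.
  set e := Fintype.equivFin (Σ i, Fin (N i)) with he
  set θ : NetWeights (Fin k × Fin m) (Fin q) (Fintype.card (Σ i, Fin (N i))) 0 :=
    ⟨⟨Matrix.of fun j p => w (e.symm j).1 (e.symm j).2 p, fun j => b (e.symm j).1 (e.symm j).2⟩,
      Fin.elim0,
      ⟨Matrix.of fun i j => if (e.symm j).1 = i then c (e.symm j).1 (e.symm j).2 else 0, 0⟩⟩ with hθ
  obtain ⟨M₁, hM₁⟩ := θ.1.exists_boundedBy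
  obtain ⟨M₂, hM₂⟩ := θ.2.2.exists_boundedBy
  refine ⟨_, max 1 (max M₁ M₂), by positivity, θ.toFun σ, ⟨θ, ⟨hM₁ _ ?_, fun l => l.elim0, hM₂ _ ?_⟩,
    rfl⟩, fun y hy => ?_⟩
  · exact (le_max_left _ _).trans (le_max_right _ _)
  · exact (le_max_right _ _).trans (le_max_right _ _)
  have hval : ∀ i, θ.toFun σ y i = ∑ j, c i j * σ ((∑ p, w i j p * y p.1 p.2) + b i j) := by
    intro i
    rw [toFun_apply, hθ]
    simp only [Matrix.of_apply, Pi.zero_apply, add_zero]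
    rw [e.symm.sum_comp (fun z : Σ i, Fin (N i) =>
      (if z.1 = i then c z.1 z.2 else 0) * σ ((∑ p, w z.1 z.2 p * y p.1 p.2) + b z.1 z.2)),
      Fintype.sum_sigma, Finset.sum_eq_single i]
    · simp
    · intro r _ hr
      simp [hr]
    · simp
  refine (EuclideanSpace.norm_le_sum_abs _).trans ?_
  calc ∑ i, |(θ.toFun σ y - γ y) i| ≤ ∑ _i : Fin q, ε / (q + 1) := by
        refine Finset.sum_le_sum fun i _ => ?_
        rw [PiLp.sub_apply, hval]
        exact (h i y hy).le
    _ = q * (ε / (q + 1)) := by simp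
    _ ≤ ε := by
        rw [mul_div_assoc', div_le_iff₀ (by positivity)]
        nlinarith

end Networks

/-! ### Uniform convergence of empirical risks -/

section Learning

open Filter Topology ProbabilityTheory

/-- The weak law of large numbers for a bounded function, with Chebyshev's rate. -/
theorem measure_pi_average_deviation_le {E : Type*} [MeasurableSpace E] (μ : Measure E)
    [IsProbabilityMeasure μ] {g : E → ℝ} (hg : Measurable g) {C : ℝ} (hC : ∀ x, |g x| ≤ C)
    {N : ℕ} (hN : 0 < N) {η : ℝ} (hη : 0 < η) :
    (Measure.pi fun _ : Fin N => μ) {s | η ≤ |(N : ℝ)⁻¹ * ∑ j, g (s j) - ∫ x, g x ∂μ|} ≤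
      ENNReal.ofReal (C ^ 2 / (N * η ^ 2)) := by
  have hN' : (0 : ℝ) < N := Nat.cast_pos.2 hN
  have hmem : MemLp g 2 μ := MemLp.of_bound hg.aestronglyMeasurable C (Eventually.of_forall hC)
  set P := Measure.pi fun _ : Fin N => μ with hP
  set Z : (Fin N → E) → ℝ := ∑ j, fun s => g (s j) with hZ
  have hev : ∀ j : Fin N, MeasurePreserving (fun s : Fin N → E => s j) P μ := fun j =>
    measurePreserving_eval _ j
  have hmemj : ∀ j : Fin N, MemLp (fun s : Fin N → E => g (s j)) 2 P := fun j =>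
    hmem.comp_measurePreserving (hev j)
  have hZmem : MemLp Z 2 P := memLp_finsetSum' _ fun j _ => hmemj j
  have hvar : variance Z P ≤ N * C ^ 2 := by
    rw [hZ, hP, variance_sum_pi (X := fun _ : Fin N => g) fun _ => hmem]
    have : variance g μ ≤ C ^ 2 := by
      have := variance_le_sq_of_bounded (μ := μ) (X := g) (a := -C) (b := C)
        (Eventually.of_forall fun x => abs_le.1 (hC x)) hg.aemeasurable
      rwa [show (C - -C) / 2 = C by ring] at this
    simpa using mul_le_mul_of_nonneg_left this hN'.le
  have hmean : ∫ s, Z s ∂P = N * ∫ x, g x ∂μ := by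
    simp only [hZ, Finset.sum_apply]
    rw [integral_finsetSum _ fun j _ => (hmemj j).integrable (by norm_num)]
    have : ∀ j : Fin N, ∫ s, g (s j) ∂P = ∫ x, g x ∂μ := fun j => by
      rw [← (hev j).map_eq]
      exact (integral_map (hev j).measurable.aemeasurable hg.aestronglyMeasurable).symm
    simp [this]
  have hcheb := meas_ge_le_variance_div_sq hZmem (mul_pos hN' hη)
  have hset : {s : Fin N → E | η ≤ |(N : ℝ)⁻¹ * ∑ j, g (s j) - ∫ x, g x ∂μ|} =
      {s | N * η ≤ |Z s - ∫ s, Z s ∂P|} := by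
    ext s
    simp only [mem_ofPred_eq, hmean]
    simp only [hZ, Finset.sum_apply]
    rw [← mul_le_mul_iff_right₀ hN']
    rw [← abs_of_pos hN', ← abs_mul, abs_of_pos hN', mul_sub, mul_inv_cancel_left₀ hN'.ne']
  rw [hset]
  refine hcheb.trans (ENNReal.ofReal_le_ofReal ?_)
  rw [div_le_div_iff₀ (by positivity) (by positivity)]
  have : variance Z P * (N * η ^ 2) ≤ N * C ^ 2 * (N * η ^ 2) := by gcongr
  linarith [show N * C ^ 2 * (N * η ^ 2) = C ^ 2 * (N * η) ^ 2 by ring]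

/-- A finite net for a compact family of continuous functions. -/
theorem exists_finset_uniform_net {Θ E : Type*} [TopologicalSpace Θ] [TopologicalSpace E]
    {P : Set Θ} (hP : IsCompact P) {X : Set E} (hX : IsCompact X) {ℓ : Θ → E → ℝ}
    (hℓ : ContinuousOn (Function.uncurry ℓ) (P ×ˢ X)) {η : ℝ} (hη : 0 < η) :
    ∃ t : Finset Θ, ↑t ⊆ P ∧ ∀ θ ∈ P, ∃ θ' ∈ t, ∀ x ∈ X, |ℓ θ x - ℓ θ' x| < η := by
  have hloc : ∀ θ₀ ∈ P, {θ | ∀ x ∈ X, |ℓ θ x - ℓ θ₀ x| < η} ∈ 𝓝[P] θ₀ := by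
    intro θ₀ hθ₀
    obtain ⟨v, hv, h⟩ := hX.mem_uniformity_of_prod hℓ hθ₀ (Metric.dist_mem_uniformity hη)
    filter_upwards [hv] with θ hθ x hx
    exact h θ hθ x hx
  obtain ⟨t, htP, ht⟩ := hP.elim_nhdsWithin_subcover _ hloc
  refine ⟨t, htP, fun θ hθ => ?_⟩
  obtain ⟨θ', hθ', h⟩ := mem_iUnion₂.1 (ht hθ)
  exact ⟨θ', hθ', h⟩

/-- Uniformly over a compact family of continuous functions, expectations exceed empirical
averages only by a small amount. -/
theorem exists_uniform_deviation {Θ E : Type*} [TopologicalSpace Θ] [TopologicalSpace E]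
    [T2Space E] [MeasurableSpace E] [BorelSpace E] (μ : Measure E) [IsProbabilityMeasure μ]
    {P : Set Θ} (hP : IsCompact P) {X : Set E} (hX : IsCompact X) (hμX : μ Xᶜ = 0) {ℓ : Θ → E → ℝ}
    (hℓ : ContinuousOn (Function.uncurry ℓ) (P ×ˢ X)) {η δ : ℝ} (hη : 0 < η) (hδ : 0 < δ) :
    ∃ N₀ : ℕ, 0 < N₀ ∧ ∀ N ≥ N₀, ∃ B : Set (Fin N → E), MeasurableSet B ∧
      ENNReal.ofReal (1 - δ) ≤ (Measure.pi fun _ : Fin N => μ) B ∧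
      (∀ s ∈ B, ∀ j, s j ∈ X) ∧
      ∀ s ∈ B, ∀ θ ∈ P, ∫ x, ℓ θ x ∂μ ≤ (N : ℝ)⁻¹ * ∑ j, ℓ θ (s j) + η := by
  classical
  have hη3 : 0 < η / 3 := by positivity
  obtain ⟨t, htP, ht⟩ := exists_finset_uniform_net hP hX hℓ hη3
  obtain ⟨C₀, hC₀⟩ := (hP.prod hX).exists_bound_of_continuousOn hℓ
  set C := max C₀ 0 with hC
  have hXm := hX.measurableSet
  have haeX : ∀ᵐ x ∂μ, x ∈ X := by rwa [ae_iff]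
  have hcont : ∀ θ ∈ P, ContinuousOn (ℓ θ) X := fun θ hθ =>
    hℓ.comp (by fun_prop : ContinuousOn (fun x => (θ, x)) X) fun x hx => ⟨hθ, hx⟩
  -- The functions ℓ θ are controlled only on X. Cutting them off makes them bounded and measurable
  -- and leaves the integrals unchanged, since μ lives on X.
  set g : Θ → E → ℝ := fun θ => X.indicator (ℓ θ) with hg
  have hgm : ∀ θ ∈ P, Measurable (g θ) := fun θ hθ => by
    have := (hcont θ hθ).measurable_piecewise (g := 0) continuous_zero.continuousOn hXm
    rwa [piecewise_eq_indicator] at this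
  have hgb : ∀ θ ∈ P, ∀ x, |g θ x| ≤ C := by
    intro θ hθ x
    by_cases hx : x ∈ X
    · simp only [hg, indicator_of_mem hx]
      exact (hC₀ (θ, x) ⟨hθ, hx⟩).trans (le_max_left _ _)
    · simp only [hg, indicator_of_notMem hx, abs_zero]
      exact le_max_right _ _
  have hgi : ∀ θ ∈ P, Integrable (g θ) μ := fun θ hθ =>
    (MemLp.of_bound (p := 1) (hgm θ hθ).aestronglyMeasurable C
      (Eventually.of_forall (hgb θ hθ))).integrable le_rfl
  have hgℓ : ∀ θ, ∫ x, ℓ θ x ∂μ = ∫ x, g θ x ∂μ := fun θ =>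
    integral_congr_ae (haeX.mono fun x hx => (indicator_of_mem hx (ℓ θ)).symm)
  -- Chebyshev gives failure probability C² / (N (η/3)²) at each net point; this N brings the sum
  -- over the net below δ.
  obtain ⟨N₁, hN₁⟩ := exists_nat_ge (t.card * C ^ 2 / ((η / 3) ^ 2 * δ))
  refine ⟨N₁ + 1, Nat.succ_pos _, fun N hN => ?_⟩
  have hNpos : 0 < N := lt_of_lt_of_le (Nat.succ_pos _) hN
  have hN' : (0 : ℝ) < N := Nat.cast_pos.2 hNpos
  set Pr := Measure.pi fun _ : Fin N => μ with hPr
  set dev : Θ → Set (Fin N → E) := fun θ =>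
    {s | η / 3 ≤ |(N : ℝ)⁻¹ * ∑ j, g θ (s j) - ∫ x, g θ x ∂μ|} with hdev
  set A : Set (Fin N → E) := {s | ∀ j, s j ∈ X} with hA
  have hAm : MeasurableSet A := by
    have : A = Set.univ.pi fun _ => X := by ext s; simp [hA]
    rw [this]
    exact MeasurableSet.univ_pi fun _ => hXm
  have hA0 : Pr Aᶜ = 0 := by
    have : ∀ j : Fin N, ∀ᵐ s ∂Pr, s j ∈ X := fun j =>
      (measurePreserving_eval (fun _ : Fin N => μ) j).quasiMeasurePreserving.ae haeX
    exact ae_iff.1 (ae_all_iff.2 this)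
  have hdevm : ∀ θ ∈ P, MeasurableSet (dev θ) := by
    intro θ hθ
    refine measurableSet_le measurable_const ?_
    have : ∀ j : Fin N, Measurable fun s : Fin N → E => g θ (s j) := fun j =>
      (hgm θ hθ).comp (measurable_pi_apply j)
    exact (((Finset.measurable_fun_sum _ fun j _ => this j).const_mul _).sub_const _).abs
  set U := ⋃ θ ∈ t, dev θ with hU
  have hUm : MeasurableSet U := Finset.measurableSet_biUnion _ fun θ hθ => hdevm θ (htP hθ)
  have hUle : Pr U ≤ ENNReal.ofReal δ := by
    calc Pr U ≤ ∑ θ ∈ t, Pr (dev θ) := measure_biUnion_finset_le _ _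
      _ ≤ ∑ _θ ∈ t, ENNReal.ofReal (C ^ 2 / (N * (η / 3) ^ 2)) :=
          Finset.sum_le_sum fun θ hθ =>
            measure_pi_average_deviation_le μ (hgm θ (htP hθ)) (hgb θ (htP hθ)) hNpos hη3
      _ = ENNReal.ofReal (t.card * (C ^ 2 / (N * (η / 3) ^ 2))) := by
          rw [Finset.sum_const, nsmul_eq_mul, ENNReal.ofReal_mul (Nat.cast_nonneg _),
            ENNReal.ofReal_natCast]
      _ ≤ ENNReal.ofReal δ := by
          refine ENNReal.ofReal_le_ofReal ?_
          have h1 : t.card * C ^ 2 / ((η / 3) ^ 2 * δ) ≤ N :=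
            hN₁.trans (by exact_mod_cast (Nat.le_succ _).trans hN)
          rw [div_le_iff₀ (by positivity)] at h1
          rw [mul_div_assoc', div_le_iff₀ (by positivity)]
          linarith
  refine ⟨A \ U, hAm.diff hUm, ?_, fun s hs => hs.1, fun s hs θ hθ => ?_⟩
  · have h1 : (1 : ℝ≥0∞) ≤ Pr (A \ U) + ENNReal.ofReal δ := by
      calc (1 : ℝ≥0∞) = Pr univ := measure_univ.symm
        _ ≤ Pr ((A \ U) ∪ (Aᶜ ∪ U)) := measure_mono fun s _ => by
            by_cases h1 : s ∈ A <;> by_cases h2 : s ∈ U <;> simp [h1, h2]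
        _ ≤ Pr (A \ U) + (Pr Aᶜ + Pr U) :=
            (measure_union_le _ _).trans (add_le_add le_rfl (measure_union_le _ _))
        _ ≤ Pr (A \ U) + ENNReal.ofReal δ := by rw [hA0, zero_add]; gcongr
    rw [ENNReal.ofReal_sub _ hδ.le, ENNReal.ofReal_one]
    exact tsub_le_iff_right.2 h1
  -- Three errors of η / 3: from θ to the net point in expectation, the deviation at the net point,
  -- and back to θ on the sample.
  · obtain ⟨θ', hθ', hclose⟩ := ht θ hθ
    have hsU : s ∉ dev θ' := fun h => hs.2 (mem_biUnion hθ' h)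
    simp only [hdev, mem_ofPred_eq, not_le] at hsU
    have h1 : ∫ x, g θ x ∂μ ≤ ∫ x, g θ' x ∂μ + η / 3 := by
      have : ∫ x, g θ x ∂μ ≤ ∫ x, (g θ' x + η / 3) ∂μ := by
        refine integral_mono_ae (hgi θ hθ) ((hgi θ' (htP hθ')).add (integrable_const _)) ?_
        filter_upwards [haeX] with x hx
        simp only [hg, indicator_of_mem hx]
        linarith [(abs_lt.1 (hclose x hx)).2]
      rwa [integral_add (hgi θ' (htP hθ')) (integrable_const _), integral_const, probReal_univ,
        one_smul] at this
    have h2 : (N : ℝ)⁻¹ * ∑ j, g θ' (s j) ≤ (N : ℝ)⁻¹ * ∑ j, ℓ θ (s j) + η / 3 := by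
      have h3 : ∑ j, g θ' (s j) ≤ ∑ j, (ℓ θ (s j) + η / 3) := by
        refine Finset.sum_le_sum fun j _ => ?_
        simp only [hg, indicator_of_mem (hs.1 j)]
        linarith [(abs_lt.1 (hclose _ (hs.1 j))).1]
      rw [Finset.sum_add_distrib, Finset.sum_const, Finset.card_univ, Fintype.card_fin,
        nsmul_eq_mul] at h3
      calc (N : ℝ)⁻¹ * ∑ j, g θ' (s j) ≤ (N : ℝ)⁻¹ * (∑ j, ℓ θ (s j) + N * (η / 3)) := by gcongr
        _ = _ := by rw [mul_add, inv_mul_cancel_left₀ hN'.ne']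
    rw [hgℓ]
    linarith [(abs_lt.1 hsU).1]

/-- Empirical risk minimization over a compact parameter set with a nearly exact parameter. -/
theorem exists_sampleSize_of_approx {Θ E : Type} [TopologicalSpace Θ] [TopologicalSpace E]
    [T2Space E] [MeasurableSpace E] [BorelSpace E] (μ : Measure E) [IsProbabilityMeasure μ]
    {P : Set Θ} (hP : IsCompact P) {X : Set E} (hX : IsCompact X) (hμX : μ Xᶜ = 0)
    {times : Finset ℕ} (htimes : times.Nonempty) {loss : Θ → ℕ → E → ℝ}
    (hloss : ∀ l, ContinuousOn (fun p : Θ × E => loss p.1 l p.2) (P ×ˢ X))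
    (hnonneg : ∀ θ l x, 0 ≤ loss θ l x) {ε δ : ℝ} (hε : 0 < ε) (hδ : 0 < δ)
    (happrox : ∃ θ ∈ P, ∀ l ∈ times, ∀ x ∈ X, loss θ l x ≤ ε / 2) :
    ∃ N₀ : ℕ, ∀ N ≥ N₀, ∃ B : Set (Fin N → E), MeasurableSet B ∧
      ENNReal.ofReal (1 - δ) ≤ (Measure.pi fun _ : Fin N => μ) B ∧
      (∀ s ∈ B, ∀ j, s j ∈ X) ∧
      ∀ s ∈ B, ∀ θ ∈ P, IsMinOn (fun θ => empiricalRisk s times (loss θ)) P θ →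
        populationRisk μ times (loss θ) ≤ ENNReal.ofReal ε := by
  obtain ⟨θ₀, hθ₀, happ⟩ := happrox
  have hcard : (0 : ℝ) < times.card := Nat.cast_pos.2 htimes.card_pos
  set ℓ : Θ → E → ℝ := fun θ x => (times.card : ℝ)⁻¹ * ∑ l ∈ times, loss θ l x with hℓ
  have hℓc : ContinuousOn (Function.uncurry ℓ) (P ×ˢ X) :=
    continuousOn_const.mul (continuousOn_finsetSum _ fun l _ => hloss l)
  obtain ⟨N₀, hN₀, H⟩ := exists_uniform_deviation μ hP hX hμX hℓc (half_pos hε) hδ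
  refine ⟨N₀, fun N hN => ?_⟩
  obtain ⟨B, hBm, hBp, hBX, hB⟩ := H N hN
  have hN' : (0 : ℝ) < N := Nat.cast_pos.2 (hN₀.trans_le hN)
  refine ⟨B, hBm, hBp, hBX, fun s hs θ hθ hmin => ?_⟩
  have hemp : ∀ θ, empiricalRisk s times (loss θ) = (N : ℝ)⁻¹ * ∑ j, ℓ θ (s j) := by
    intro θ
    simp only [empiricalRisk, hℓ]
    rw [← Finset.mul_sum, ← mul_assoc, mul_inv]
  -- θ₀ is accurate at every point of X, so this holds for every sample in X and needs no
  -- concentration.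
  have h0 : empiricalRisk s times (loss θ₀) ≤ ε / 2 := by
    rw [empiricalRisk, inv_mul_le_iff₀ (by positivity)]
    calc ∑ j, ∑ l ∈ times, loss θ₀ l (s j) ≤ ∑ _j : Fin N, ∑ _l ∈ times, ε / 2 :=
          Finset.sum_le_sum fun j _ => Finset.sum_le_sum fun l hl => happ l hl _ (hBX s hs j)
      _ = N * times.card * (ε / 2) := by simp [mul_assoc]
  have h1 : empiricalRisk s times (loss θ) ≤ empiricalRisk s times (loss θ₀) := hmin hθ₀
  have h2 := hB s hs θ hθ
  rw [← hemp] at h2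
  have h3 : ∫ x, ℓ θ x ∂μ ≤ ε := by linarith
  have haeX : ∀ᵐ x ∂μ, x ∈ X := by rwa [ae_iff]
  have hrestr : μ.restrict X = μ := Measure.restrict_eq_self_of_ae_mem haeX
  have hcl : ∀ l, ContinuousOn (loss θ l) X := fun l =>
    (hloss l).comp (by fun_prop : ContinuousOn (fun x => (θ, x)) X) fun x hx => ⟨hθ, hx⟩
  have hint : ∀ l, Integrable (loss θ l) μ := fun l => by
    have := (hcl l).integrableOn_compact (μ := μ) hX
    rwa [IntegrableOn, hrestr] at this
  have hsum : ∫ x, ℓ θ x ∂μ = (times.card : ℝ)⁻¹ * ∑ l ∈ times, ∫ x, loss θ l x ∂μ := by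
    simp only [hℓ]
    rw [integral_const_mul, integral_finsetSum _ fun l _ => hint l]
  have hpop : populationRisk μ times (loss θ) = ENNReal.ofReal (∫ x, ℓ θ x ∂μ) := by
    rw [hsum, ENNReal.ofReal_mul (by positivity), ENNReal.ofReal_inv_of_pos hcard,
      ENNReal.ofReal_natCast, ENNReal.ofReal_sum_of_nonneg
        fun l _ => integral_nonneg (hnonneg θ l), populationRisk]
    congr 1
    refine Finset.sum_congr rfl fun l _ => ?_
    rw [ofReal_integral_eq_lintegral_ofReal (hint l) (Eventually.of_forall (hnonneg θ l))]
  rw [hpop]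
  exact ENNReal.ofReal_le_ofReal h3

end Learning

/-! ### Learning the latent dynamics, the decoder and the flow -/

section Autoregression

open Filter Topology

theorem continuousOn_squared_error {Θ A B E : Type*} [TopologicalSpace Θ] [TopologicalSpace A]
    [NormedAddCommGroup B] [TopologicalSpace E] {F : Θ → A → B}
    (hF : Continuous fun p : Θ × A => F p.1 p.2) (P : Set Θ) {X : Set E}
    {feature : E → A} (hfeature : ContinuousOn feature X)
    {target : E → B} (htarget : ContinuousOn target X) :
    ContinuousOn (fun p : Θ × E => ‖F p.1 (feature p.2) - target p.2‖ ^ 2) (P ×ˢ X) := by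
  have hsnd : MapsTo (Prod.snd : Θ × E → E) (P ×ˢ X) X := fun p hp => hp.2
  have h1 : ContinuousOn (fun p : Θ × E => (p.1, feature p.2)) (P ×ˢ X) :=
    continuousOn_fst.prodMk (hfeature.comp continuousOn_snd hsnd)
  have h2 : ContinuousOn (fun p : Θ × E => F p.1 (feature p.2)) (P ×ˢ X) :=
    hF.comp_continuousOn h1
  have h3 : ContinuousOn (fun p : Θ × E => target p.2) (P ×ˢ X) :=
    htarget.comp continuousOn_snd hsnd
  exact (h2.sub h3).norm.pow 2

/-- Networks PAC-learn a continuous relation between features and targets by empirical risk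
minimization. -/
theorem exists_networkClass_learns {E : Type} [TopologicalSpace E] [T2Space E] [MeasurableSpace E]
    [BorelSpace E] (μ : Measure E) [IsProbabilityMeasure μ] {X : Set E} (hX : IsCompact X)
    (hμX : μ Xᶜ = 0) {σ : ℝ → ℝ} {Lσ : ℝ≥0} (hσ : LipschitzWith Lσ σ)
    (hna : ¬ ∃ a b : ℝ, ∀ x, σ x = a * x + b) {k m q : ℕ} {times : Finset ℕ}
    (htimes : times.Nonempty) {Q : Set (Fin k → EuclideanSpace ℝ (Fin m))} (hQ : IsCompact Q)
    {feature : ℕ → E → Fin k → EuclideanSpace ℝ (Fin m)} {target : ℕ → E → EuclideanSpace ℝ (Fin q)}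
    (hfeature : ∀ l, ContinuousOn (feature l) X) (htarget : ∀ l, ContinuousOn (target l) X)
    (hmaps : ∀ l, MapsTo (feature l) X Q)
    {γ : (Fin k → EuclideanSpace ℝ (Fin m)) → EuclideanSpace ℝ (Fin q)} (hγ : ContinuousOn γ Q)
    (hγtarget : ∀ l ∈ times, ∀ x ∈ X, γ (feature l x) = target l x)
    {loss : ((Fin k → EuclideanSpace ℝ (Fin m)) → EuclideanSpace ℝ (Fin q)) → ℕ → E → ℝ}
    (hloss : ∀ η l x, loss η l x = ‖η (feature l x) - target l x‖ ^ 2)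
    {ε δ : ℝ} (hε : 0 < ε) (hδ : 0 < δ) :
    ∃ (W : ℕ) (M : ℝ), 0 < M ∧ ∃ N₀ : ℕ, ∀ N ≥ N₀,
      (∃ est : (Fin N → E) → _, IsERM X times loss (networkClass σ k m q W 0 M) est) ∧
      ∃ B : Set (Fin N → E), MeasurableSet B ∧
        ENNReal.ofReal (1 - δ) ≤ (Measure.pi fun _ : Fin N => μ) B ∧ (∀ s ∈ B, ∀ j, s j ∈ X) ∧
        ∀ est : (Fin N → E) → _, IsERM X times loss (networkClass σ k m q W 0 M) est →
          ∀ s ∈ B, populationRisk μ times (loss (est s)) ≤ ENNReal.ofReal ε := by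
  obtain ⟨W, M, hM, η₀, ⟨θ₀, hθ₀, rfl⟩, happ⟩ :=
    exists_network_approx (q := q) hσ hna hQ hγ (Real.sqrt_pos.2 (half_pos hε))
  set P : Set (NetWeights (Fin k × Fin m) (Fin q) W 0) := {θ | θ.BoundedBy M} with hPdef
  have hP : IsCompact P := isCompact_setOf_boundedBy _ _ W 0 M
  have hc := continuous_toFun (k := k) (m := m) (q := q) (W := W) hσ.continuous
  set lossΘ : NetWeights (Fin k × Fin m) (Fin q) W 0 → ℕ → E → ℝ := fun θ => loss (θ.toFun σ)
    with hlossΘ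
  obtain ⟨N₀, hN₀⟩ := exists_sampleSize_of_approx μ hP hX hμX htimes (loss := lossΘ)
    (fun l => by
      simp only [hlossΘ, hloss]
      exact continuousOn_squared_error hc P (hfeature l) (htarget l))
    (fun θ l x => by simp only [hlossΘ, hloss]; positivity) hε hδ
    ⟨θ₀, hθ₀, fun l hl x hx => by
      simp only [hlossΘ, hloss]
      have := happ _ (hmaps l hx)
      rw [hγtarget l hl x hx] at this
      calc ‖θ₀.toFun σ (feature l x) - target l x‖ ^ 2 ≤ Real.sqrt (ε / 2) ^ 2 := by gcongr
        _ = ε / 2 := Real.sq_sqrt (half_pos hε).le⟩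
  refine ⟨W, M, hM, N₀, fun N hN => ⟨?_, ?_⟩⟩
  · have hmin : ∀ s : Fin N → E, ∃ θ ∈ P, IsMinOn (fun θ => empiricalRisk s times (lossΘ θ)) P θ := by
      intro s
      refine hP.exists_isMinOn ⟨θ₀, hθ₀⟩ (Continuous.continuousOn ?_)
      refine continuous_const.mul (continuous_finsetSum _ fun j _ =>
        continuous_finsetSum _ fun l _ => ?_)
      simp only [hlossΘ, hloss]
      have h1 : Continuous fun θ : NetWeights (Fin k × Fin m) (Fin q) W 0 =>
          θ.toFun σ (feature l (s j)) := hc.comp (continuous_id.prodMk continuous_const)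
      exact (h1.sub continuous_const).norm.pow 2
    choose θ hθ hθmin using hmin
    refine ⟨fun s => (θ s).toFun σ, fun s _ => ⟨⟨θ s, hθ s, rfl⟩, ?_⟩⟩
    rintro _ ⟨θ', hθ', rfl⟩
    exact hθmin s hθ'
  · obtain ⟨B, hBm, hBp, hBX, hB⟩ := hN₀ N hN
    refine ⟨B, hBm, hBp, hBX, fun est hest s hs => ?_⟩
    obtain ⟨⟨θ, hθ, hθs⟩, hmin⟩ := hest s (hBX s hs)
    rw [hθs] at hmin ⊢
    exact hB s hs θ hθ fun θ' hθ' => hmin ⟨θ', hθ', rfl⟩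

/-- A single time has weight 1 / card in the uniform average, so its error is recovered at the cost
of a factor card. -/
theorem lintegral_le_card_mul_populationRisk {E : Type} [MeasurableSpace E] (μ : Measure E)
    {times : Finset ℕ} {l : ℕ} (hl : l ∈ times) (loss : ℕ → E → ℝ) :
    ∫⁻ x, ENNReal.ofReal (loss l x) ∂μ ≤ times.card * populationRisk μ times loss := by
  have hcard : (times.card : ℝ≥0∞) ≠ 0 := by
    exact_mod_cast (Finset.card_pos.2 ⟨l, hl⟩).ne'
  rw [populationRisk, ← mul_assoc, ENNReal.mul_inv_cancel hcard (by simp), one_mul]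
  exact Finset.single_le_sum (f := fun l => ∫⁻ x, ENNReal.ofReal (loss l x) ∂μ)
    (fun _ _ => zero_le) hl

theorem norm_shiftAppend_sub_le {k m : ℕ} (y : Fin k → EuclideanSpace ℝ (Fin m))
    (a b : EuclideanSpace ℝ (Fin m)) : ‖shiftAppend y a - shiftAppend y b‖ ≤ ‖a - b‖ := by
  refine (pi_norm_le_iff_of_nonneg (norm_nonneg _)).2 fun i => ?_
  rw [Pi.sub_apply]
  by_cases hi : (i : ℕ) + 1 < k
  · simp [shiftAppend, hi]
  · simp [shiftAppend, hi]

theorem ofReal_one_sub_le_measure_inter {Ω : Type*} [MeasurableSpace Ω] (P : Measure Ω)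
    [IsProbabilityMeasure P] {A B : Set Ω} (hB : MeasurableSet B) {δ : ℝ}
    (hPA : ENNReal.ofReal (1 - δ) ≤ P A) (hPB : ENNReal.ofReal (1 - δ) ≤ P B) :
    ENNReal.ofReal (1 - 2 * δ) ≤ P (A ∩ B) := by
  have hreal : ∀ C : Set Ω, ENNReal.ofReal (1 - δ) ≤ P C → 1 - δ ≤ P.real C := fun C hC => by
    rw [Measure.real]
    exact (ENNReal.ofReal_le_iff_le_toReal (measure_ne_top P C)).1 hC
  have h := measureReal_union_add_inter (μ := P) (s := A) hB
  have h1 : P.real (A ∪ B) ≤ 1 := measureReal_le_one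
  rw [ENNReal.ofReal_le_iff_le_toReal (measure_ne_top P _)]
  change _ ≤ P.real (A ∩ B)
  linarith [hreal A hPA, hreal B hPB]

variable {n m : ℕ} {f : EuclideanSpace ℝ (Fin n) → EuclideanSpace ℝ (Fin n)} {L : ℝ≥0}
  {X : Set (EuclideanSpace ℝ (Fin n))} {h : EuclideanSpace ℝ (Fin n) → EuclideanSpace ℝ (Fin m)}

/-- The past of the state at time t is the recorded history of x; this trades windows at time 0 for
training windows. -/
theorem ySeq_zero_flow (hf : LipschitzWith L f) (Δ : ℝ) (k : ℕ) (t : ℝ)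
    (x : EuclideanSpace ℝ (Fin n)) :
    ySeq f h Δ k 0 (flow f t x) = ySeq f h Δ k t x := by
  funext i
  simp only [ySeq, token]
  rw [← flow_add hf]
  congr 2
  ring

/-- With the exact next token appended, the decoder sees a genuine window, so its own loss measures
the error. -/
theorem shiftAppend_ySeq {k : ℕ} (Δ t : ℝ)
    (x : EuclideanSpace ℝ (Fin n)) :
    shiftAppend (ySeq f h Δ k t x) (token f h (t + Δ) x) = ySeq f h Δ k (t + Δ) x := by
  funext i
  by_cases hi : (i : ℕ) + 1 < k
  · simp only [shiftAppend, hi, dif_pos, ySeq]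
    congr 1
    push_cast
    ring
  · have hik : k = (i : ℕ) + 1 := by omega
    have hik' : (k : ℝ) = (i : ℕ) + 1 := by exact_mod_cast hik
    simp only [shiftAppend, hi, dif_neg, not_false_eq_true, ySeq, hik']
    congr 1
    ring

theorem continuousOn_token (hf : LipschitzWith L f) (hX : IsCompact X)
    (hXb : HasDifferentiableBoundary X) (hfX : IsTangentialTo f X) (hh : ContinuousOn h X) (t : ℝ) :
    ContinuousOn (token f h t) X :=
  hh.comp (continuous_flow hf t).continuousOn fun _ hx => flow_mem hf hX hXb hfX hx t

theorem continuousOn_ySeq (hf : LipschitzWith L f) (hX : IsCompact X)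
    (hXb : HasDifferentiableBoundary X) (hfX : IsTangentialTo f X) (hh : ContinuousOn h X)
    (Δ : ℝ) (k : ℕ) (t : ℝ) : ContinuousOn (ySeq f h Δ k t) X :=
  continuousOn_pi.2 fun _ => continuousOn_token hf hX hXb hfX hh _

theorem mapsTo_ySeq (hf : LipschitzWith L f) (hX : IsCompact X)
    (hXb : HasDifferentiableBoundary X) (hfX : IsTangentialTo f X) (Δ : ℝ) (k : ℕ) (t : ℝ) :
    MapsTo (ySeq f h Δ k t) X (Set.univ.pi fun _ => h '' X) :=
  fun _ hx _ _ => ⟨_, flow_mem hf hX hXb hfX hx _, rfl⟩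

/-- The full-state risk is controlled by the risks of the latent predictor and of the decoder, with
a constant that depends only on the system and on the Lipschitz constant of the decoder. -/
theorem exists_riskFullState_le (hf : LipschitzWith L f) (hX : IsCompact X)
    (hXb : HasDifferentiableBoundary X) (hfX : IsTangentialTo f X) (hh : ContinuousOn h X)
    (Δ : ℝ) {k K : ℕ} (hK : k < K)
    {fμ : EuclideanSpace ℝ (Fin n) → ℝ} (hfμ : ContinuousOn fμ X) (hfμpos : ∀ x ∈ X, 0 < fμ x)
    {μ : Measure (EuclideanSpace ℝ (Fin n))} (hμX : μ Xᶜ = 0)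
    (hμ : μ = (volume.restrict X).withDensity fun x => ENNReal.ofReal (fμ x)) :
    ∃ C : ℝ≥0, ∀ (ηg : (Fin k → EuclideanSpace ℝ (Fin m)) → EuclideanSpace ℝ (Fin m))
      (ηG : (Fin k → EuclideanSpace ℝ (Fin m)) → EuclideanSpace ℝ (Fin n)) (Λ ε : ℝ),
      0 ≤ Λ → 0 < ε → (∀ y y', ‖ηG y - ηG y'‖ ≤ Λ * ‖y - y'‖) →
      riskLatent f h μ Δ k K ηg ≤ ENNReal.ofReal (ε / (1 + Λ ^ 2)) →
      riskDecoder f h μ Δ k K ηG ≤ ENNReal.ofReal ε →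
      riskFullState f h μ Δ k ηg ηG ≤ C * ENNReal.ofReal ε := by
  -- kΔ is the first latent training time.
  obtain ⟨C, hC⟩ := exists_lintegral_le_lintegral_flow hf hX hXb hfX hfμ hfμpos hμ (k * Δ)
  refine ⟨C * (2 * (timesDecoder k K).card + 2 * (timesLatent k K).card),
    fun ηg ηG Λ ε hΛ hε hηG hg hG => ?_⟩
  -- Compare with the decoder fed the exact next token: its error is the decoder loss at index k +
  -- 1, and exchanging the token costs at most Λ times the latent error.
  have hpt : ∀ x, ‖flow f Δ (flow f (k * Δ) x) - ηG (shiftAppend (ySeq f h Δ k 0 (flow f (k * Δ) x))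
        (ηg (ySeq f h Δ k 0 (flow f (k * Δ) x))))‖ ^ 2 ≤
      2 * decoderLoss f h Δ k ηG (k + 1) x + 2 * Λ ^ 2 * latentLoss f h Δ k ηg k x := by
    intro x
    have ht : ((k + 1 : ℕ) : ℝ) * Δ = k * Δ + Δ := by push_cast; ring
    rw [ySeq_zero_flow hf, ← flow_add hf, add_comm Δ, decoderLoss, latentLoss, ht]
    set y := ySeq f h Δ k (k * Δ) x with hy
    set z := flow f (k * Δ + Δ) x with hz
    rw [← shiftAppend_ySeq (h := h), ← hy]
    set a := token f h (k * Δ + Δ) x with ha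
    have h1 : ‖ηG (shiftAppend y (ηg y)) - ηG (shiftAppend y a)‖ ≤ Λ * ‖ηg y - a‖ :=
      (hηG _ _).trans (mul_le_mul_of_nonneg_left (norm_shiftAppend_sub_le _ _ _) hΛ)
    have h2 : ‖z - ηG (shiftAppend y (ηg y))‖ ≤
        ‖ηG (shiftAppend y a) - z‖ + Λ * ‖ηg y - a‖ := by
      have := norm_sub_le_norm_sub_add_norm_sub z (ηG (shiftAppend y a)) (ηG (shiftAppend y (ηg y)))
      rw [norm_sub_rev z (ηG (shiftAppend y a)),
        norm_sub_rev (ηG (shiftAppend y a)) (ηG (shiftAppend y (ηg y)))] at this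
      linarith
    calc ‖z - ηG (shiftAppend y (ηg y))‖ ^ 2
        ≤ (‖ηG (shiftAppend y a) - z‖ + Λ * ‖ηg y - a‖) ^ 2 := by gcongr
      _ ≤ 2 * ‖ηG (shiftAppend y a) - z‖ ^ 2 + 2 * Λ ^ 2 * ‖ηg y - a‖ ^ 2 := by
          nlinarith [sq_nonneg (‖ηG (shiftAppend y a) - z‖ - Λ * ‖ηg y - a‖)]
  -- The indices k and k + 1 are training times exactly because k < K.
  have hlat : k ∈ timesLatent k K := by
    simp only [timesLatent, Finset.mem_sdiff, Finset.mem_range, Finset.mem_union,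
      Finset.mem_singleton]
    omega
  have hdec : k + 1 ∈ timesDecoder k K := by
    simp only [timesDecoder, Finset.mem_sdiff, Finset.mem_range]
    omega
  have hηGc : Continuous ηG := by
    refine (LipschitzWith.of_dist_le_mul (K := Λ.toNNReal) fun y y' => ?_).continuous
    rw [dist_eq_norm, dist_eq_norm, Real.coe_toNNReal _ hΛ]
    exact hηG y y'
  -- Splitting the integral of the sum needs one measurable summand. The decoder loss provides it,
  -- as `ηg` is arbitrary.
  have hmeas : AEMeasurable
      (fun x => ENNReal.ofReal (2 * decoderLoss f h Δ k ηG (k + 1) x)) μ := by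
    have hcont : ContinuousOn (fun x => 2 * decoderLoss f h Δ k ηG (k + 1) x) X :=
      continuousOn_const.mul (((hηGc.comp_continuousOn
        (continuousOn_ySeq hf hX hXb hfX hh Δ k _)).sub
          (continuous_flow hf _).continuousOn).norm.pow 2)
    have haeX : ∀ᵐ x ∂μ, x ∈ X := by rwa [ae_iff]
    have := hcont.aemeasurable (μ := μ) hX.measurableSet
    rw [Measure.restrict_eq_self_of_ae_mem haeX] at this
    exact this.ennreal_ofReal
  have hG' := lintegral_le_card_mul_populationRisk μ hdec (decoderLoss f h Δ k ηG)
  have hg' := lintegral_le_card_mul_populationRisk μ hlat (latentLoss f h Δ k ηg)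
  have hG'' : ∫⁻ x, ENNReal.ofReal (2 * decoderLoss f h Δ k ηG (k + 1) x) ∂μ ≤
      2 * (timesDecoder k K).card * ENNReal.ofReal ε := by
    simp_rw [ENNReal.ofReal_mul (zero_le_two (α := ℝ)), ENNReal.ofReal_ofNat]
    rw [lintegral_const_mul' _ _ (by simp), mul_assoc]
    gcongr
    exact hG'.trans (by gcongr; exact hG)
  have hg'' : ∫⁻ x, ENNReal.ofReal (2 * Λ ^ 2 * latentLoss f h Δ k ηg k x) ∂μ ≤
      2 * (timesLatent k K).card * ENNReal.ofReal ε := by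
    have hΛ2 : (0 : ℝ) ≤ 2 * Λ ^ 2 := by positivity
    simp_rw [ENNReal.ofReal_mul hΛ2]
    rw [lintegral_const_mul' _ _ ENNReal.ofReal_ne_top]
    calc ENNReal.ofReal (2 * Λ ^ 2) * ∫⁻ x, ENNReal.ofReal (latentLoss f h Δ k ηg k x) ∂μ
        ≤ ENNReal.ofReal (2 * Λ ^ 2) *
            ((timesLatent k K).card * ENNReal.ofReal (ε / (1 + Λ ^ 2))) := by
          gcongr
          exact hg'.trans (by gcongr; exact hg)
      _ = (timesLatent k K).card * ENNReal.ofReal (2 * Λ ^ 2 * (ε / (1 + Λ ^ 2))) := by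
          rw [ENNReal.ofReal_mul hΛ2]; ring
      -- Λ² / (1 + Λ²) ≤ 1 removes Λ from the final constant.
      _ ≤ (timesLatent k K).card * ENNReal.ofReal (2 * ε) := by
          refine mul_le_mul_right (ENNReal.ofReal_le_ofReal ?_) _
          rw [mul_div_assoc', div_le_iff₀ (by positivity)]
          nlinarith
      _ = _ := by
          rw [ENNReal.ofReal_mul zero_le_two, ENNReal.ofReal_ofNat]; ring
  calc riskFullState f h μ Δ k ηg ηG
      ≤ C * ∫⁻ x, ENNReal.ofReal (‖flow f Δ (flow f (k * Δ) x) -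
          ηG (shiftAppend (ySeq f h Δ k 0 (flow f (k * Δ) x))
            (ηg (ySeq f h Δ k 0 (flow f (k * Δ) x))))‖ ^ 2) ∂μ :=
        hC fun x => ENNReal.ofReal (‖flow f Δ x -
          ηG (shiftAppend (ySeq f h Δ k 0 x) (ηg (ySeq f h Δ k 0 x)))‖ ^ 2)
    _ ≤ C * ∫⁻ x, (ENNReal.ofReal (2 * decoderLoss f h Δ k ηG (k + 1) x) +
          ENNReal.ofReal (2 * Λ ^ 2 * latentLoss f h Δ k ηg k x)) ∂μ := by
        gcongr with x
        exact (ENNReal.ofReal_le_ofReal (hpt x)).trans ENNReal.ofReal_add_le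
    _ ≤ C * (2 * (timesDecoder k K).card * ENNReal.ofReal ε +
          2 * (timesLatent k K).card * ENNReal.ofReal ε) := by
        rw [lintegral_add_left' hmeas]
        gcongr
    _ = _ := by
        push_cast
        ring

end Autoregression

/-! ### Choice of the accuracies and combination of the two learners -/

theorem theorem2
    {n m : ℕ}
    -- the dynamical system on the compact state space `X`
    (f : EuclideanSpace ℝ (Fin n) → EuclideanSpace ℝ (Fin n)) (L : ℝ≥0) (hf : LipschitzWith L f)
    (X : Set (EuclideanSpace ℝ (Fin n))) (hX : IsCompact X)
    (hXb : HasDifferentiableBoundary X) (hfX : IsTangentialTo f X)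
    -- the tokenization map
    (h : EuclideanSpace ℝ (Fin n) → EuclideanSpace ℝ (Fin m)) (hh : ContinuousOn h X)
    -- time step `Δ`, history length `k`, observation time `T = K Δ`
    (Δ : ℝ) (hΔ : 0 < Δ) (k K : ℕ) (hk : 1 ≤ k) (hK : k < K)
    -- observability: the continuous reconstruction map `G : Y^k → X`, where `Y = h(X)`
    (G : (Fin k → EuclideanSpace ℝ (Fin m)) → EuclideanSpace ℝ (Fin n))
    (hGcont : ContinuousOn G (Set.univ.pi fun _ => h '' X))
    (hGmaps : Set.MapsTo G (Set.univ.pi fun _ => h '' X) X)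
    (hGrec : ∀ x₀ ∈ X, ∀ l : ℕ, k ≤ l + 1 → l ≤ K →
      G (ySeq f h Δ k (l * Δ) x₀) = flow f (l * Δ) x₀)
    -- the distribution of the initial conditions, with a continuous positive density on `X`
    (μ : Measure (EuclideanSpace ℝ (Fin n))) [IsProbabilityMeasure μ]
    (fμ : EuclideanSpace ℝ (Fin n) → ℝ) (hfμ : ContinuousOn fμ X) (hfμpos : ∀ x ∈ X, 0 < fμ x)
    (hμ : μ = (volume.restrict X).withDensity fun x => ENNReal.ofReal (fμ x))
    -- the activation function: Lipschitz and not affine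
    (σ : ℝ → ℝ) (Lσ : ℝ≥0) (hσ : LipschitzWith Lσ σ)
    (hσ_na : ¬ ∃ a b : ℝ, ∀ x, σ x = a * x + b) :
    ∃ (Hg : ℝ → ℝ → Set ((Fin k → EuclideanSpace ℝ (Fin m)) → EuclideanSpace ℝ (Fin m)))
      (HG : ℝ → ℝ → Set ((Fin k → EuclideanSpace ℝ (Fin m)) → EuclideanSpace ℝ (Fin n)))
      (N₀ : ℝ → ℝ → ℕ),
      -- the hypothesis spaces and sample sizes PAC-learn `g` and `G`
      (∀ ε' δ' : ℝ, 0 < ε' → 0 < δ' →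
        IsNetworkHypothesisSpace σ (Hg ε' δ') ∧ IsNetworkHypothesisSpace σ (HG ε' δ') ∧
        ∀ N : ℕ, N₀ ε' δ' ≤ N →
          -- empirical risk minimizers exist
          (∃ est : (Fin N → EuclideanSpace ℝ (Fin n)) → _,
            IsERM X (timesLatent k K) (latentLoss f h Δ k) (Hg ε' δ') est) ∧
          (∃ est : (Fin N → EuclideanSpace ℝ (Fin n)) → _,
            IsERM X (timesDecoder k K) (decoderLoss f h Δ k) (HG ε' δ') est) ∧
          (∀ est : (Fin N → EuclideanSpace ℝ (Fin n)) → _,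
            IsERM X (timesLatent k K) (latentLoss f h Δ k) (Hg ε' δ') est →
            ProbAtLeast (Measure.pi fun _ : Fin N => μ) (1 - δ')
              {s | riskLatent f h μ Δ k K (est s) ≤ ENNReal.ofReal ε'}) ∧
          (∀ est : (Fin N → EuclideanSpace ℝ (Fin n)) → _,
            IsERM X (timesDecoder k K) (decoderLoss f h Δ k) (HG ε' δ') est →
            ProbAtLeast (Measure.pi fun _ : Fin N => μ) (1 - δ')
              {s | riskDecoder f h μ Δ k K (est s) ≤ ENNReal.ofReal ε'})) ∧
      -- the composed predictor PAC-learns the flow `S_Δ`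
      (∀ ε δ : ℝ, 0 < ε → 0 < δ → ∃ ε' δ' : ℝ, 0 < ε' ∧ 0 < δ' ∧
        ∀ N : ℕ, N₀ ε' δ' ≤ N →
          ∀ (estg : (Fin N → EuclideanSpace ℝ (Fin n)) →
              (Fin k → EuclideanSpace ℝ (Fin m)) → EuclideanSpace ℝ (Fin m))
            (estG : (Fin N → EuclideanSpace ℝ (Fin n)) →
              (Fin k → EuclideanSpace ℝ (Fin m)) → EuclideanSpace ℝ (Fin n)),
            IsERM X (timesLatent k K) (latentLoss f h Δ k) (Hg ε' δ') estg →
            IsERM X (timesDecoder k K) (decoderLoss f h Δ k) (HG ε' δ') estG →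
            ProbAtLeast (Measure.pi fun _ : Fin N => μ) (1 - δ)
              {s | riskFullState f h μ Δ k (estg s) (estG s) ≤ ENNReal.ofReal ε}) := by
  have hμX : μ Xᶜ = 0 := by
    rw [hμ]
    refine withDensity_absolutelyContinuous _ _ ?_
    rw [Measure.restrict_apply hX.measurableSet.compl, compl_inter_self, measure_empty]
  obtain ⟨C, hC⟩ := exists_riskFullState_le hf hX hXb hfX hh Δ hK hfμ hfμpos hμX hμ
  set Q : Set (Fin k → EuclideanSpace ℝ (Fin m)) := Set.univ.pi fun _ => h '' X with hQdef
  have hQ : IsCompact Q := isCompact_univ_pi fun _ => hX.image_of_continuousOn hh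
  have hg : ContinuousOn (fun y => h (flow f Δ (G y))) Q :=
    (continuousOn_token hf hX hXb hfX hh Δ).comp hGcont hGmaps
  have hlatne : (timesLatent k K).Nonempty := ⟨k, by
    simp only [timesLatent, Finset.mem_sdiff, Finset.mem_range, Finset.mem_union,
      Finset.mem_singleton]
    omega⟩
  have hdecne : (timesDecoder k K).Nonempty := ⟨k, by
    simp only [timesDecoder, Finset.mem_sdiff, Finset.mem_range]
    omega⟩
  have hlat : ∀ l ∈ timesLatent k K, ∀ x ∈ X,
      h (flow f Δ (G (ySeq f h Δ k (l * Δ) x))) = token f h (l * Δ + Δ) x := by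
    intro l hl x hx
    simp only [timesLatent, Finset.mem_sdiff, Finset.mem_range, Finset.mem_union,
      Finset.mem_singleton] at hl
    rw [hGrec x hx l (by omega) (by omega), token, ← flow_add hf, add_comm]
  have hdec : ∀ l ∈ timesDecoder k K, ∀ x ∈ X,
      G (ySeq f h Δ k (l * Δ) x) = flow f (l * Δ) x := by
    intro l hl x hx
    simp only [timesDecoder, Finset.mem_sdiff, Finset.mem_range] at hl
    exact hGrec x hx l (by omega) (by omega)
  -- Positivity is a premise inside the existential, so that the classes can be chosen for all real
  -- parameters, with ∅ as a dummy value. The events precede the estimators: one pair serves all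
  -- minimizers.
  have key : ∀ ε' δ' : ℝ,
      ∃ (Hg : Set ((Fin k → EuclideanSpace ℝ (Fin m)) → EuclideanSpace ℝ (Fin m)))
        (HG : Set ((Fin k → EuclideanSpace ℝ (Fin m)) → EuclideanSpace ℝ (Fin n))) (N₀ : ℕ),
        0 < ε' → 0 < δ' →
        IsNetworkHypothesisSpace σ Hg ∧ IsNetworkHypothesisSpace σ HG ∧
        ∀ N : ℕ, N₀ ≤ N →
          (∃ est : (Fin N → EuclideanSpace ℝ (Fin n)) → _,
            IsERM X (timesLatent k K) (latentLoss f h Δ k) Hg est) ∧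
          (∃ est : (Fin N → EuclideanSpace ℝ (Fin n)) → _,
            IsERM X (timesDecoder k K) (decoderLoss f h Δ k) HG est) ∧
          ∃ Bg BG : Set (Fin N → EuclideanSpace ℝ (Fin n)), MeasurableSet Bg ∧ MeasurableSet BG ∧
            ENNReal.ofReal (1 - δ') ≤ (Measure.pi fun _ : Fin N => μ) Bg ∧
            ENNReal.ofReal (1 - δ') ≤ (Measure.pi fun _ : Fin N => μ) BG ∧
            (∀ est, IsERM X (timesLatent k K) (latentLoss f h Δ k) Hg est → ∀ s ∈ Bg,
              riskLatent f h μ Δ k K (est s) ≤ ENNReal.ofReal ε') ∧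
            (∀ est, IsERM X (timesDecoder k K) (decoderLoss f h Δ k) HG est → ∀ s ∈ BG,
              riskDecoder f h μ Δ k K (est s) ≤ ENNReal.ofReal ε') ∧
            ∀ estg estG, IsERM X (timesLatent k K) (latentLoss f h Δ k) Hg estg →
              IsERM X (timesDecoder k K) (decoderLoss f h Δ k) HG estG → ∀ s ∈ Bg ∩ BG,
              riskFullState f h μ Δ k (estg s) (estG s) ≤ C * ENNReal.ofReal ε' := by
    intro ε' δ'
    by_cases hpos : 0 < ε' ∧ 0 < δ'
    swap
    · exact ⟨∅, ∅, 0, fun h1 h2 => absurd ⟨h1, h2⟩ hpos⟩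
    obtain ⟨hε', hδ'⟩ := hpos
    -- The decoder class must come first: it determines Λ, and Λ determines the accuracy asked of
    -- the latent class.
    obtain ⟨WG, MG, hMG, NG, hNG⟩ := exists_networkClass_learns μ hX hμX hσ hσ_na hdecne hQ
      (feature := fun l => ySeq f h Δ k (l * Δ)) (target := fun l => flow f (l * Δ))
      (fun l => continuousOn_ySeq hf hX hXb hfX hh Δ k _)
      (fun l => (continuous_flow hf _).continuousOn)
      (fun l => mapsTo_ySeq hf hX hXb hfX Δ k _) hGcont hdec
      (loss := decoderLoss f h Δ k) (fun _ _ _ => rfl) hε' hδ'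
    obtain ⟨Λ, hΛ, hΛG⟩ := exists_lipschitz_toFun hσ k m n WG hMG
    have hεg : 0 < ε' / (1 + Λ ^ 2) := by positivity
    have hεle : ε' / (1 + Λ ^ 2) ≤ ε' := div_le_self hε'.le (by nlinarith [sq_nonneg Λ])
    obtain ⟨Wg, Mg, hMg, Ng, hNg⟩ := exists_networkClass_learns μ hX hμX hσ hσ_na hlatne hQ
      (feature := fun l => ySeq f h Δ k (l * Δ)) (target := fun l => token f h (l * Δ + Δ))
      (fun l => continuousOn_ySeq hf hX hXb hfX hh Δ k _)
      (fun l => continuousOn_token hf hX hXb hfX hh _)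
      (fun l => mapsTo_ySeq hf hX hXb hfX Δ k _) hg hlat
      (loss := latentLoss f h Δ k) (fun _ _ _ => rfl) hεg hδ'
    refine ⟨networkClass σ k m m Wg 0 Mg, networkClass σ k m n WG 0 MG, max Ng NG, fun _ _ =>
      ⟨⟨Wg, 0, Mg, hMg, rfl⟩, ⟨WG, 0, MG, hMG, rfl⟩, fun N hN => ?_⟩⟩
    obtain ⟨hexg, Bg, hBgm, hBgp, -, hBg⟩ := hNg N ((le_max_left _ _).trans hN)
    obtain ⟨hexG, BG, hBGm, hBGp, hBGX, hBG⟩ := hNG N ((le_max_right _ _).trans hN)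
    refine ⟨hexg, hexG, Bg, BG, hBgm, hBGm, hBgp, hBGp,
      fun est hest s hs => (hBg est hest s hs).trans (ENNReal.ofReal_le_ofReal hεle), hBG,
      fun estg estG hestg hestG s hs => ?_⟩
    exact hC _ _ Λ ε' hΛ hε' (hΛG _ (hestG s (hBGX s hs.2)).1) (hBg estg hestg s hs.1)
      (hBG estG hestG s hs.2)
  choose Hg HG N₀ hkey using key
  refine ⟨Hg, HG, N₀, fun ε' δ' hε' hδ' => ?_, fun ε δ hε hδ => ?_⟩
  · obtain ⟨h1, h2, h3⟩ := hkey ε' δ' hε' hδ'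
    refine ⟨h1, h2, fun N hN => ?_⟩
    obtain ⟨e1, e2, Bg, BG, mg, mG, pg, pG, rg, rG, -⟩ := h3 N hN
    exact ⟨e1, e2, fun est hest => ⟨Bg, rg est hest, mg, pg⟩,
      fun est hest => ⟨BG, rG est hest, mG, pG⟩⟩
  -- C may be 0, hence C + 1. Halving δ pays for intersecting two events on the same sample.
  · have hε' : 0 < ε / (C + 1) := by positivity
    refine ⟨ε / (C + 1), δ / 2, hε', half_pos hδ, fun N hN estg estG hg hG => ?_⟩
    obtain ⟨-, -, h3⟩ := hkey _ _ hε' (half_pos hδ)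
    obtain ⟨-, -, Bg, BG, mg, mG, pg, pG, -, -, rS⟩ := h3 N hN
    refine ⟨Bg ∩ BG, fun s hs => (rS estg estG hg hG s hs).trans ?_, mg.inter mG, ?_⟩
    · rw [← ENNReal.ofReal_coe_nnreal, ← ENNReal.ofReal_mul C.coe_nonneg]
      refine ENNReal.ofReal_le_ofReal ?_
      rw [mul_div_assoc', div_le_iff₀ (by positivity)]
      nlinarith
    · have := ofReal_one_sub_le_measure_inter _ mG pg pG
      rwa [mul_div_cancel₀ _ (two_ne_zero (α := ℝ))] at this
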